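/- Fix an integer $T\ge 0$. All objects below are sequences indexed by the dimension $n\ge 1$, and "constant" means independent of $n$. Consider $n$-dependent sets $\mathcal P=\bigsqcup_{t=0}^T\mathcal P_t$, where $\mathcal P_t$ consists of functions $\mathbb R^{n\times t}\to\mathbb R^n$ ($\mathcal P_0$ consists of constant vectors in $\mathbb R^n$). **Local functions.** A function $f:\mathbb R^{n\times t}\to\mathbb R^n$ is $A$-local if for each $i\in[n]$ there are $A_i\subseteq[n]$ and $\mathring f_i:\mathbb R^{|A_i|\times t}\to\mathbb R$ with $f(z)[i]=\mathring f_i(z[A_i])$, where $z[A_i]$ denotes the rows of $z$ in $A_i$, and for each $i\in[n]$, $|A_i|\le A$ and $|\{j:i\in A_j\}|\le A$. $\mathcal P$ is a set of *polynomial local functions* if for some constants $A,D,B>0$ every $p\in\mathcal P$ is $A$-local with all $\mathring p_i$ polynomials of degree at most $D$ and with coefficients bounded in magnitude by $B$. $\mathcal F$ is a set of *Lipschitz local functions* if for some constants $A,L>0$ every $f\in\mathcal F$ is $A$-local with $|\mathring f_i(0)|\le L$ and $|\mathring f_i(x)-\mathring f_i(y)|\le L\|x-y\|_F$ for all $i,x,y$.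 **BCP.** A set of tensors $\mathcal T=\bigsqcup_{k=1}^K\mathcal T_k$ with $\mathcal T_k\subseteq(\mathbb R^n)^{\otimes k}$ satisfies the *Bounded Composition Property* if for all fixed $m,\ell\ge1$, $k_1,\dots,k_m\in\{1,\dots,K\}$ and all surjections $\pi$ from $\{(a,j):1\le a\le m,\ 1\le j\le k_a\}$ onto $[\ell]$ such that every fibre of $\pi$ has even cardinality, and there is no partition of $[m]$ into two nonempty sets $S,S'$ with $\pi(\{(a,j):a\in S\})$ and $\pi(\{(a,j):a\in S'\})$ disjoint, there is a constant $C>0$ with $$\limsup_{n\to\infty}\ \sup_{T_1\in\mathcal T_{k_1},\dots,T_m\in\mathcal T_{k_m}}\frac1n\Big|\sum_{i_1,\dots,i_\ell=1}^n\ \prod_{a=1}^m T_a[i_{\pi(a,1)},\dots,i_{\pi(a,k_a)}]\Big|\le C.$$ $\mathcal P$ is *BCP-representable* if there are a constant integer $D\ge0$ and a set of tensors $\mathcal T=\bigsqcup_{k=1}^{D+1}\mathcal T_k$ satisfying the BCP such that each $p\in\mathcal P_t$ can be written as $$p(z_1,\dots,z_t)=T^{(0)}+\sum_{d=1}^D\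 \sum_{\sigma:[d]\to[t]}T^{(\sigma)}[z_{\sigma(1)},\dots,z_{\sigma(d)},\cdot\,],\qquad T^{(0)}\in\mathcal T_1,\ T^{(\sigma)}\in\mathcal T_{d+1},$$ where $T[z_1,\dots,z_d,\cdot\,][j]=\sum_{i_1,\dots,i_d}T[i_1,\dots,i_d,j]\,z_1[i_1]\cdots z_d[i_d]$. **BCP-approximability.** For a covariance matrix $\Sigma\in\mathbb R^{t\times t}$, $N(0,\Sigma\otimes\mathrm{Id}_n)$ is the law on $\mathbb R^{n\times t}$ with i.i.d. rows of law $N(0,\Sigma)$. $\mathcal F=\bigsqcup_{t=0}^T\mathcal F_t$ is *BCP-approximable* if for all fixed $C_0,\epsilon>0$: 1. There is a BCP-representable set $\mathcal P=\bigsqcup_{t=0}^T\mathcal P_t$ such that for all $t\in\{0,\dots,T\}$, $f\in\mathcal F_t$ and covariance matrices $\Sigma\in\mathbb R^{t\times t}$ with $\|\Sigma\|_{\mathrm{op}}<C_0$ there is $p=p_{f,\Sigma}\in\mathcal P_t$ with $\frac1n\mathbb E_{Z\sim N(0,\Sigma\otimes\mathrm{Id}_n)}\|f(Z)-p(Z)\|_2^2<\epsilon$,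 and such that, for every $S\subseteq[t]$, if $f$ depends only on the input columns in $S$, then so does $p$. 2. There is a set $\mathcal Q=\bigsqcup_{t=0}^T\mathcal Q_t$ of polynomial functions such that for every $t\in\{1,\dots,T\}$: (i) $\mathcal P\cup\{q_1,q_2\}$ is BCP-representable for all $n$-indexed sequences $q_1,q_2\in\mathcal Q_t$ of degrees bounded independently of $n$; and (ii) for all $n$-indexed sequences of $f\in\mathcal F_t$, covariance matrices $\Sigma\in\mathbb R^{t\times t}$ with $\|\Sigma\|_{\mathrm{op}}<C_0$, and possibly random $z\in\mathbb R^{n\times t}$ (defined on a common probability space), if for all such $q_1,q_2$, almost surely $$\lim_{n\to\infty}\ \frac1n q_1(z)^\top q_2(z)-\frac1n\mathbb E_{Z\sim N(0,\Sigma\otimes\mathrm{Id}_n)}\,q_1(Z)^\top q_2(Z)=0,$$ then for the polynomials $p=p_{f,\Sigma}$ of (1), $\limsup_{n\to\infty}\frac1n\|f(z)-p(z)\|_2^2<\epsilon$ almost surely. **Proposition.** (a) Every set $\mathcal P=\bigsqcup_{t=0}^T\mathcal P_t$ of polynomial local functions is BCP-representable. (b) Every set $\mathcal F=\bigsqcup_{t=0}^T\mathcal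 F_t$ of Lipschitz local functions is BCP-approximable. In particular, for $T\ge1$ this applies to $\{f_0,\dots,f_{T-1},\phi_1,\phi_2\}$ with $f_t:\mathbb R^{n\times t}\to\mathbb R^n$ and $\phi_1,\phi_2:\mathbb R^{n\times T}\to\mathbb R^n$. -/

import Mathlib

open MeasureTheory ProbabilityTheory Filter Topology

universe u

/-- `ℝ^{n × t}`: the entry in row `i` and column `s` is `z i s`. -/
abbrev RMat (n t : ℕ) : Type := Fin n → Fin t → ℝ

/-- Functions `ℝ^{n × t} → ℝ^n`; for `t = 0` these are the constant vectors in `ℝ^n`. -/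
abbrev VecFn (n t : ℕ) : Type := RMat n t → Fin n → ℝ

/-- Tensors of order `k` in dimension `n`. -/
abbrev Tensor (n k : ℕ) : Type := (Fin k → Fin n) → ℝ

/-- An `n`-indexed family of sets `𝒫(n) = ⨆_{t=0}^T 𝒫_t(n)` (disjoint union) of functions, where
`𝒫_t(n)` consists of functions `ℝ^{n × t} → ℝ^n`. Membership `f ∈ 𝒫_t(n)` reads `⟨t, f⟩ ∈ P n`.
The dimension is a positive integer; the value at `n = 0` is never used. -/
abbrev FnFamily (T : ℕ) : Type := ∀ n : ℕ, Set (Σ t : Fin (T + 1), VecFn n t)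

/-- An `n`-indexed family of sets of tensors, `𝒯 n k` being the tensors of order `k`. -/
abbrev TensorFamily : Type := ∀ n k : ℕ, Set (Tensor n k)

/-! ### Bounded Composition Property -/

/-- The two conditions on the index map `π` that attaches to position `j` of the `a`-th tensor (of
order `k a`) one of `ℓ` summation indices: every index is used, and an even number of times, and
the tensors cannot be split into two nonempty groups with disjoint index sets. -/
structure AdmissibleMap {m ℓ : ℕ} (k : Fin m → ℕ) (π : (Σ a : Fin m, Fin (k a)) → Fin ℓ) :
    Prop where
  surjective : Function.Surjective π
  even : ∀ j : Fin ℓ, Even (Finset.univ.filter fun x => π x = j).card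
  connected : ¬ ∃ S : Finset (Fin m), S.Nonempty ∧ Sᶜ.Nonempty ∧
    Disjoint (π '' {x | x.1 ∈ S}) (π '' {x | x.1 ∈ Sᶜ})

/-- The composition `∑_{i_1,…,i_ℓ} ∏_a U_a[i_{π(a,1)}, …, i_{π(a,k_a)}]`. -/
noncomputable def tensorComposition {n m ℓ : ℕ} (k : Fin m → ℕ)
    (π : (Σ a : Fin m, Fin (k a)) → Fin ℓ) (U : ∀ a : Fin m, Tensor n (k a)) : ℝ :=
  ∑ i : Fin ℓ → Fin n, ∏ a : Fin m, U a (fun j => i (π ⟨a, j⟩))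

/-- The Bounded Composition Property of `𝒯 = ⨆_{k=1}^K 𝒯_k`: for every fixed admissible pattern,
the normalized compositions are, for all large `n`, bounded by a constant uniformly over the
tensors of `𝒯(n)`. -/
def SatisfiesBCP (K : ℕ) (𝒯 : TensorFamily) : Prop :=
  ∀ (m ℓ : ℕ), 1 ≤ m → 1 ≤ ℓ →
  ∀ (k : Fin m → ℕ), (∀ a, 1 ≤ k a ∧ k a ≤ K) →
  ∀ (π : (Σ a : Fin m, Fin (k a)) → Fin ℓ), AdmissibleMap k π →
  ∃ C : ℝ, 0 < C ∧ ∀ᶠ n : ℕ in atTop,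
    ∀ U : ∀ a : Fin m, Tensor n (k a), (∀ a, U a ∈ 𝒯 n (k a)) →
      (1 / (n : ℝ)) * |tensorComposition k π U| ≤ C

/-! ### BCP-representability -/

/-- The partial contraction `T[z_{σ(1)}, …, z_{σ(d)}, ·] ∈ ℝ^n` of an order-`(d+1)` tensor with
columns of `z`. -/
noncomputable def contract {n t d : ℕ} (U : Tensor n (d + 1)) (z : RMat n t)
    (σ : Fin d → Fin t) (j : Fin n) : ℝ :=
  ∑ i : Fin d → Fin n, U (Fin.snoc i j) * ∏ a : Fin d, z (i a) (σ a)

/-- `P` is BCP-representable: for a degree bound `D` and tensors satisfying the BCP, each member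
is `p(z) = T⁰ + ∑_{d=1}^D ∑_{σ : [d] → [t]} T^σ[z_{σ(1)}, …, z_{σ(d)}, ·]`. -/
def BCPRepresentable {T : ℕ} (P : FnFamily T) : Prop :=
  ∃ (D : ℕ) (𝒯 : TensorFamily), SatisfiesBCP (D + 1) 𝒯 ∧
    ∀ n : ℕ, 1 ≤ n → ∀ (t : Fin (T + 1)) (p : VecFn n t), ⟨t, p⟩ ∈ P n →
      ∃ U₀ ∈ 𝒯 n 1, ∃ U : ∀ d : ℕ, (Fin d → Fin t) → Tensor n (d + 1),
        (∀ d ∈ Finset.Icc 1 D, ∀ σ, U d σ ∈ 𝒯 n (d + 1)) ∧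
        ∀ (z : RMat n t) (j : Fin n),
          p z j = U₀ (fun _ => j) +
            ∑ d ∈ Finset.Icc 1 D, ∑ σ : Fin d → Fin t, contract (U d σ) z σ j

/-! ### BCP-approximability -/

/-- `f` depends only on the columns of its input that belong to `S`. -/
def DependsOnCols {n t : ℕ} (S : Set (Fin t)) (f : VecFn n t) : Prop :=
  ∀ z z' : RMat n t, (∀ i, ∀ s ∈ S, z i s = z' i s) → f z = f z'

/-- Every coordinate of `q` is a polynomial in the entries of the input, of total degree at
most `D`. -/
def IsPolyFn {n t : ℕ} (D : ℕ) (q : VecFn n t) : Prop :=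
  ∀ i : Fin n, ∃ r : MvPolynomial (Fin n × Fin t) ℝ, r.totalDegree ≤ D ∧
    ∀ z : RMat n t, q z i = MvPolynomial.eval (fun x => z x.1 x.2) r

/-- The law `N(0, Σ ⊗ Id_n)` on `ℝ^{n × t}`: the rows are i.i.d. with law `N(0, Σ)`. -/
noncomputable def gaussianRows (n : ℕ) {t : ℕ} (Sig : Matrix (Fin t) (Fin t) ℝ) :
    Measure (RMat n t) :=
  Measure.pi fun _ : Fin n =>
    (multivariateGaussian (0 : EuclideanSpace ℝ (Fin t)) Sig).map WithLp.ofLp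

/-- `Σ` is a covariance matrix with `ℓ²`-operator norm less than `C₀`. -/
def IsCovBelow {t : ℕ} (C₀ : ℝ) (Sig : Matrix (Fin t) (Fin t) ℝ) : Prop :=
  Sig.PosSemidef ∧ ‖Matrix.toEuclideanCLM (n := Fin t) (𝕜 := ℝ) Sig‖ < C₀

/-- `n⁻¹ ‖v - w‖₂²`. -/
noncomputable def meanSqDist {n : ℕ} (v w : Fin n → ℝ) : ℝ :=
  (1 / (n : ℝ)) * ∑ i, (v i - w i) ^ 2

/-- `n⁻¹ q₁(z)ᵀ q₂(z)`. -/
noncomputable def meanInner {n t : ℕ} (q₁ q₂ : VecFn n t) (z : RMat n t) : ℝ :=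
  (1 / (n : ℝ)) * ∑ i, q₁ z i * q₂ z i

/-- The family `P ∪ {q₁, q₂}`. -/
def adjoinPair {T : ℕ} (P : FnFamily T) (t : Fin (T + 1)) (q₁ q₂ : ∀ n : ℕ, VecFn n t) :
    FnFamily T :=
  fun n => P n ∪ {⟨t, q₁ n⟩, ⟨t, q₂ n⟩}

/-- A sequence of members of `Q_t` whose degrees are bounded independently of `n`. -/
def IsBoundedDegreeSeq {T : ℕ} (Q : FnFamily T) (t : Fin (T + 1)) (q : ∀ n : ℕ, VecFn n t) :
    Prop :=
  (∀ n, 1 ≤ n → ⟨t, q n⟩ ∈ Q n) ∧ ∃ D : ℕ, ∀ n, 1 ≤ n → IsPolyFn D (q n)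

/-- Condition (1) of BCP-approximability for a family `P`. Here `pol n t f Σ` is the polynomial
`p ∈ P_t(n)` that is chosen for `f` and `Σ`; condition (2) refers to this same polynomial. -/
def ApproximatedBy {T : ℕ} (F P : FnFamily T) (C₀ ε : ℝ)
    (pol : ∀ (n : ℕ) (t : Fin (T + 1)), VecFn n t → Matrix (Fin t) (Fin t) ℝ → VecFn n t) :
    Prop :=
  ∀ n : ℕ, 1 ≤ n → ∀ (t : Fin (T + 1)) (f : VecFn n t), ⟨t, f⟩ ∈ F n →
    ∀ Sig : Matrix (Fin t) (Fin t) ℝ, IsCovBelow C₀ Sig →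
      ⟨t, pol n t f Sig⟩ ∈ P n ∧
      Integrable (fun z => meanSqDist (f z) (pol n t f Sig z)) (gaussianRows n Sig) ∧
      ∫ z, meanSqDist (f z) (pol n t f Sig z) ∂(gaussianRows n Sig) < ε ∧
      ∀ S : Set (Fin t), DependsOnCols S f → DependsOnCols S (pol n t f Sig)

/-- Condition (2) of BCP-approximability for a family `Q` of polynomial functions. Adjoining any two
sequences of bounded degree from `Q_t` keeps `P` BCP-representable, and if a possibly random `z`
satisfies `n⁻¹ q₁(z)ᵀ q₂(z) - n⁻¹ 𝔼 q₁(Z)ᵀ q₂(Z) → 0` almost surely for all such pairs, then the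
polynomials chosen for `f` and `Σ` satisfy `limsup n⁻¹ ‖f(z) - p(z)‖₂² < ε` almost surely. -/
def DenselyTestedBy {T : ℕ} (F P Q : FnFamily T) (C₀ ε : ℝ)
    (pol : ∀ (n : ℕ) (t : Fin (T + 1)), VecFn n t → Matrix (Fin t) (Fin t) ℝ → VecFn n t) :
    Prop :=
  ∀ t : Fin (T + 1), 1 ≤ (t : ℕ) →
    (∀ q₁ q₂ : ∀ n : ℕ, VecFn n t,
      IsBoundedDegreeSeq Q t q₁ → IsBoundedDegreeSeq Q t q₂ →
        BCPRepresentable (adjoinPair P t q₁ q₂)) ∧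
    ∀ (f : ∀ n : ℕ, VecFn n t) (Sig : ℕ → Matrix (Fin t) (Fin t) ℝ),
      (∀ n, 1 ≤ n → ⟨t, f n⟩ ∈ F n) → (∀ n, 1 ≤ n → IsCovBelow C₀ (Sig n)) →
      ∀ (Ω : Type u) [MeasurableSpace Ω] (μ : Measure Ω) [IsProbabilityMeasure μ]
        (z : ∀ n : ℕ, Ω → RMat n t), (∀ n, Measurable (z n)) →
        (∀ q₁ q₂ : ∀ n : ℕ, VecFn n t,
          IsBoundedDegreeSeq Q t q₁ → IsBoundedDegreeSeq Q t q₂ →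
            ∀ᵐ ω ∂μ, Tendsto (fun n => meanInner (q₁ n) (q₂ n) (z n ω) -
              ∫ y, meanInner (q₁ n) (q₂ n) y ∂(gaussianRows n (Sig n))) atTop (𝓝 0)) →
        ∀ᵐ ω ∂μ, limsup (fun n => ENNReal.ofReal
          (meanSqDist (f n (z n ω)) (pol n t (f n) (Sig n) (z n ω)))) atTop < ENNReal.ofReal ε

/-- `F` is BCP-approximable. (The universe parameter is that of the sample spaces on which the
random inputs in condition (2) are defined.) -/
def BCPApproximable {T : ℕ} (F : FnFamily T) : Prop :=
  ∀ C₀ ε : ℝ, 0 < C₀ → 0 < ε →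
    ∃ (P : FnFamily T)
      (pol : ∀ (n : ℕ) (t : Fin (T + 1)), VecFn n t → Matrix (Fin t) (Fin t) ℝ → VecFn n t),
      BCPRepresentable P ∧ ApproximatedBy F P C₀ ε pol ∧
      ∃ Q : FnFamily T,
        (∀ n : ℕ, 1 ≤ n → ∀ (t : Fin (T + 1)) (q : VecFn n t), ⟨t, q⟩ ∈ Q n →
          ∃ D : ℕ, IsPolyFn D q) ∧
        DenselyTestedBy.{u} F P Q C₀ ε pol

/-! ### Local functions -/

/-- The rows `z[S]` of `z` belonging to `S`. -/
def rowsOf {n t : ℕ} (S : Finset (Fin n)) (z : RMat n t) : S → Fin t → ℝ :=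
  fun i s => z i s

/-- `|A_i| ≤ A` and `|{j : i ∈ A_j}| ≤ A` for each `i`. -/
def BoundedNeighborhoods {n : ℕ} (A : ℕ) (N : Fin n → Finset (Fin n)) : Prop :=
  ∀ i, (N i).card ≤ A ∧ (Finset.univ.filter fun j => i ∈ N j).card ≤ A

/-- A set of polynomial local functions. -/
def IsPolynomialLocal {T : ℕ} (P : FnFamily T) : Prop :=
  ∃ (A D : ℕ) (B : ℝ), 0 < A ∧ 0 < D ∧ 0 < B ∧
    ∀ n : ℕ, 1 ≤ n → ∀ (t : Fin (T + 1)) (p : VecFn n t), ⟨t, p⟩ ∈ P n →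
      ∃ N : Fin n → Finset (Fin n), BoundedNeighborhoods A N ∧
        ∃ r : ∀ i : Fin n, MvPolynomial (N i × Fin t) ℝ,
          (∀ z i, p z i = MvPolynomial.eval (fun x => rowsOf (N i) z x.1 x.2) (r i)) ∧
          ∀ i, (r i).totalDegree ≤ D ∧ ∀ e, |(r i).coeff e| ≤ B

/-- The Frobenius norm on `ℝ^{S × t}`. -/
noncomputable def frobNorm {ι : Type} [Fintype ι] {t : ℕ} (x : ι → Fin t → ℝ) : ℝ :=
  √(∑ i, ∑ s, x i s ^ 2)

/-- A set of Lipschitz local functions. -/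
def IsLipschitzLocal {T : ℕ} (F : FnFamily T) : Prop :=
  ∃ (A : ℕ) (L : ℝ), 0 < A ∧ 0 < L ∧
    ∀ n : ℕ, 1 ≤ n → ∀ (t : Fin (T + 1)) (f : VecFn n t), ⟨t, f⟩ ∈ F n →
      ∃ N : Fin n → Finset (Fin n), BoundedNeighborhoods A N ∧
        ∃ g : ∀ i : Fin n, (N i → Fin t → ℝ) → ℝ,
          (∀ z i, f z i = g i (rowsOf (N i) z)) ∧
          ∀ i, |g i 0| ≤ L ∧ ∀ x y, |g i x - g i y| ≤ L * frobNorm (x - y)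

/-! (a) Expand each output coordinate `j` of a polynomial local function into monomials. The
degree-`d` part becomes tensors whose entry at `(i₁, …, i_d, j)` is a coefficient of the `j`-th
polynomial, and it vanishes unless every `i_a` lies in `N j`. Since neighborhoods are bounded in
both directions, these tensors are sparse: entries are bounded, and fixing one index leaves
boundedly many nonzero entries. In a connected composition of sparse tensors, one index has `n`
values and each other index then has boundedly many, so the sum is `O(n)`
(`satisfiesBCP_sparseTensor`).

(b) The core is `exists_polynomial_operator`. A Lipschitz `g` of boundedly many variables is
precomposed with `x ↦ R sin (x / R)`, which maps into a cube, then replaced by its tensor Bernstein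
polynomial in `sin (x / R)`, and finally the sine is replaced by a Taylor polynomial. The squared
error is bounded pointwise, for every real input, by `ε + ∑ η (x s)`, where the univariate
polynomial `η ≥ 0` has small mean under every `N(0, v)` with `v ≤ C₀`.

Pointwise domination by a polynomial serves both halves of approximability. Integrating it gives
condition (1). Summing over coordinates and double counting neighborhoods gives one polynomial
function `H`, independent of `f` and of its neighborhoods, with `n⁻¹ ‖f - p‖² ≤ n⁻¹ Hᵀ 1` at every
input. Hence `Q = {H, 1}` suffices in condition (2): the test on the pair `(H, 1)` transfers the
small Gaussian mean of `H` to the given `z`. Dependence on columns is inherited because the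
univariate weights of the operator sum to one identically. -/

/-! ### Sparse tensors satisfy the Bounded Composition Property -/

/-- A tensor with entries bounded by `B`, in which fixing any one index to any one value leaves at
most `M` nonzero entries. -/
def SparseTensor (B : ℝ) (M : ℕ) {n k : ℕ} (U : Tensor n k) : Prop :=
  (∀ i, |U i| ≤ B) ∧
    ∀ (a : Fin k) (v : Fin n), (Finset.univ.filter fun i => i a = v ∧ U i ≠ 0).card ≤ M

/-- Two summation indices are linked when they are attached to a common tensor. -/
def LinkedIndices {m ℓ : ℕ} {k : Fin m → ℕ} (π : (Σ a : Fin m, Fin (k a)) → Fin ℓ)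
    (l l' : Fin ℓ) : Prop :=
  ∃ a j j', π ⟨a, j⟩ = l ∧ π ⟨a, j'⟩ = l'

/-- If `l'` were unreachable from `l`, the tensors carrying an index reachable from `l` and the
remaining ones would form a forbidden splitting. -/
lemma AdmissibleMap.reflTransGen_linkedIndices {m ℓ : ℕ} {k : Fin m → ℕ}
    {π : (Σ a : Fin m, Fin (k a)) → Fin ℓ} (h : AdmissibleMap k π) (l l' : Fin ℓ) :
    Relation.ReflTransGen (LinkedIndices π) l l' := by
  classical
  by_contra hl
  refine h.connected ⟨Finset.univ.filter fun a =>
    ∃ j, Relation.ReflTransGen (LinkedIndices π) l (π ⟨a, j⟩), ?_, ?_, ?_⟩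
  · obtain ⟨⟨a, j⟩, hx⟩ := h.surjective l
    exact ⟨a, by simpa using ⟨j, hx ▸ Relation.ReflTransGen.refl⟩⟩
  · obtain ⟨⟨a, j⟩, hx⟩ := h.surjective l'
    refine ⟨a, ?_⟩
    simp only [Finset.mem_compl, Finset.mem_filter, Finset.mem_univ, true_and]
    rintro ⟨j', hj'⟩
    exact hl (hj'.tail ⟨a, j', j, rfl, hx⟩)
  · rw [Set.disjoint_left]
    rintro _ ⟨⟨a, j⟩, hx, rfl⟩ ⟨⟨b, i⟩, hy, hxy⟩
    simp only [Set.mem_ofPred_eq, Finset.mem_compl, Finset.mem_filter, Finset.mem_univ,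
      true_and] at hx hy
    obtain ⟨j', hj'⟩ := hx
    exact hy ⟨i, hxy ▸ hj'.tail ⟨a, j', j, rfl, rfl⟩⟩

/-- Induction along a chain of links: knowing one argument of a nonzero entry leaves at most `M`
entries, so each link multiplies the number of possible values by at most `M`. The bound does not
involve `n`. -/
lemma exists_card_index_values_le {m ℓ : ℕ} {k : Fin m → ℕ}
    {π : (Σ a : Fin m, Fin (k a)) → Fin ℓ} {l₀ l : Fin ℓ} (M : ℕ)
    (hl : Relation.ReflTransGen (LinkedIndices π) l₀ l) :
    ∃ K : ℕ, ∀ (n : ℕ) (U : ∀ a : Fin m, Tensor n (k a)),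
      (∀ a (b : Fin (k a)) (v : Fin n),
        (Finset.univ.filter fun i => i b = v ∧ U a i ≠ 0).card ≤ M) →
      ∀ v : Fin n, ((Finset.univ.filter fun i : Fin ℓ → Fin n =>
        i l₀ = v ∧ ∀ a, U a (fun j => i (π ⟨a, j⟩)) ≠ 0).image (fun i => i l)).card ≤ K := by
  classical
  induction hl with
  | refl =>
    refine ⟨1, fun n U _ v => ?_⟩
    rw [← Finset.card_singleton v]
    refine Finset.card_le_card fun w hw => ?_
    simp only [Finset.mem_image, Finset.mem_filter, Finset.mem_univ, true_and] at hw
    obtain ⟨i, ⟨h, -⟩, rfl⟩ := hw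
    simpa using h
  | @tail l' l'' _ hlink ih =>
    obtain ⟨K, hK⟩ := ih
    obtain ⟨a, j, j', rfl, rfl⟩ := hlink
    refine ⟨K * M, fun n U hU v => ?_⟩
    set G := Finset.univ.filter fun i : Fin ℓ → Fin n =>
      i l₀ = v ∧ ∀ a, U a (fun j => i (π ⟨a, j⟩)) ≠ 0 with hG
    have hsub : G.image (fun i => i (π ⟨a, j'⟩)) ⊆
        (G.image (fun i => i (π ⟨a, j⟩))).biUnion fun w =>
          (Finset.univ.filter fun x => x j = w ∧ U a x ≠ 0).image (fun x => x j') := by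
      intro w hw
      obtain ⟨i, hi, rfl⟩ := Finset.mem_image.1 hw
      refine Finset.mem_biUnion.2 ⟨_, Finset.mem_image_of_mem _ hi, Finset.mem_image.2
        ⟨fun j => i (π ⟨a, j⟩), ?_, rfl⟩⟩
      simpa using (Finset.mem_filter.1 hi).2.2 a
    calc _ ≤ _ := Finset.card_le_card hsub
      _ ≤ _ := Finset.card_biUnion_le_card_mul _ _ M
        fun w _ => Finset.card_image_le.trans (hU a j w)
      _ ≤ K * M := Nat.mul_le_mul_right _ (hK n U hU v)

theorem satisfiesBCP_sparseTensor (K : ℕ) (B : ℝ) (hB : 0 < B) (M : ℕ) :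
    SatisfiesBCP K fun _ _ => {U | SparseTensor B M U} := by
  classical
  intro m ℓ _ hℓ k _ π hπ
  let l₀ : Fin ℓ := ⟨0, hℓ⟩
  choose κ hκ using fun l =>
    exists_card_index_values_le M (hπ.reflTransGen_linkedIndices l₀ l)
  -- The summand `1` only makes the constant positive, as some `κ l` may vanish.
  refine ⟨((∏ l, κ l : ℕ) : ℝ) * B ^ m + 1, by positivity, ?_⟩
  filter_upwards [eventually_ge_atTop 1] with n hn U hU
  set G := Finset.univ.filter fun i : Fin ℓ → Fin n =>
    ∀ a, U a (fun j => i (π ⟨a, j⟩)) ≠ 0 with hG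
  have hcard : G.card ≤ (∏ l, κ l) * n := by
    have h1 : ∀ v ∈ (Finset.univ : Finset (Fin n)),
        (G.filter fun i => i l₀ = v).card ≤ ∏ l, κ l := by
      intro v _
      have hsub : (G.filter fun i => i l₀ = v) ⊆ Fintype.piFinset fun l =>
          (Finset.univ.filter fun i : Fin ℓ → Fin n =>
            i l₀ = v ∧ ∀ a, U a (fun j => i (π ⟨a, j⟩)) ≠ 0).image (fun i => i l) := by
        intro i hi
        rw [Fintype.mem_piFinset]
        intro l
        refine Finset.mem_image_of_mem _ ?_
        simp only [hG, Finset.mem_filter, Finset.mem_univ, true_and] at hi ⊢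
        exact ⟨hi.2, hi.1⟩
      refine (Finset.card_le_card hsub).trans ?_
      rw [Fintype.card_piFinset]
      exact Finset.prod_le_prod' fun l _ => hκ l n U (fun a => (hU a).2) v
    have := Finset.card_le_mul_card_image_of_maps_to (f := fun i : Fin ℓ → Fin n => i l₀)
      (s := G) (t := Finset.univ) (fun _ _ => Finset.mem_univ _) _ h1
    simpa using this
  have hsum : |tensorComposition k π U| ≤ G.card * B ^ m := by
    have h0 : tensorComposition k π U = ∑ i ∈ G, ∏ a : Fin m, U a (fun j => i (π ⟨a, j⟩)) := by
      refine (Finset.sum_subset (Finset.subset_univ _) fun i _ hi => ?_).symm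
      simp only [hG, Finset.mem_filter, Finset.mem_univ, true_and, not_forall, not_not] at hi
      obtain ⟨a, ha⟩ := hi
      exact Finset.prod_eq_zero (Finset.mem_univ a) ha
    rw [h0]
    refine (Finset.abs_sum_le_sum_abs _ _).trans ?_
    rw [← nsmul_eq_mul]
    refine Finset.sum_le_card_nsmul _ _ _ fun i _ => ?_
    rw [Finset.abs_prod]
    refine (Finset.prod_le_prod (fun _ _ => abs_nonneg _)
      fun a _ => (hU a).1 _).trans ?_
    simp
  have hn' : (0 : ℝ) < n := by exact_mod_cast hn
  rw [one_div, inv_mul_le_iff₀ hn']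
  have hc : (G.card : ℝ) ≤ ((∏ l, κ l : ℕ) : ℝ) * n := by exact_mod_cast hcard
  have hBm : 0 ≤ B ^ m := by positivity
  nlinarith [mul_le_mul_of_nonneg_right hc hBm]

/-! ### Polynomial local functions are BCP-representable -/

/-- The exponent of the monomial `∏ a, X (x a)`. -/
noncomputable def wordExponent {Y : Type*} {d : ℕ} (x : Fin d → Y) : Y →₀ ℕ :=
  ∑ a, Finsupp.single (x a) 1

lemma degree_wordExponent {Y : Type*} {d : ℕ} (x : Fin d → Y) : (wordExponent x).degree = d := by
  simp [wordExponent, map_sum]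

lemma exists_wordExponent_eq {Y : Type*} (e : Y →₀ ℕ) :
    ∃ x : Fin e.degree → Y, wordExponent x = e := by
  classical
  have hl : e.toMultiset.toList.length = e.degree := by
    rw [Multiset.length_toList, Finsupp.card_toMultiset]; rfl
  refine ⟨fun a => e.toMultiset.toList.get (a.cast hl.symm), ?_⟩
  apply Multiset.toFinsupp.symm.injective
  rw [Multiset.toFinsupp_symm_apply, Multiset.toFinsupp_symm_apply, wordExponent, map_sum]
  simp only [Finsupp.toMultiset_single, one_smul]
  have h1 : ∑ a : Fin e.degree, ({e.toMultiset.toList.get (a.cast hl.symm)} : Multiset Y) =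
      ∑ a : Fin e.toMultiset.toList.length, {e.toMultiset.toList.get a} :=
    Fintype.sum_equiv (finCongr hl.symm) _ _ fun a => rfl
  rw [h1, ← List.sum_ofFn]
  have h2 : List.ofFn (fun a => ({e.toMultiset.toList.get a} : Multiset Y)) =
      e.toMultiset.toList.map fun y => {y} := by
    conv_rhs => rw [← List.ofFn_get e.toMultiset.toList, List.map_ofFn]
    rfl
  rw [h2]
  rw [← Multiset.sum_coe, ← Multiset.map_coe, Multiset.sum_map_singleton, Multiset.coe_toList]

lemma prod_wordExponent {Y : Type*} {d : ℕ} (x : Fin d → Y) (f : Y → ℝ) :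
    (wordExponent x).prod (fun y c => f y ^ c) = ∏ a, f (x a) := by
  rw [wordExponent, ← Finsupp.prod_finsetSum_index (by simp) (fun _ _ _ => pow_add _ _ _)]
  simp

/-- A homogeneous part of a polynomial as a sum over words of length `d`, each monomial being
carried by one word. -/
lemma exists_word_coefficients {Y : Type*} [Fintype Y] (r : MvPolynomial Y ℝ) (d : ℕ) :
    ∃ u : (Fin d → Y) → ℝ,
      (∀ x, u x = 0 ∨ u x = r.coeff (wordExponent x)) ∧
      ∀ f : Y → ℝ, ∑ x, u x * ∏ a, f (x a) =
        ∑ e ∈ r.support.filter (fun e => e.degree = d), r.coeff e * e.prod fun y c => f y ^ c := by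
  classical
  have hw : ∀ e : Y →₀ ℕ, e.degree = d → ∃ x : Fin d → Y, wordExponent x = e := by
    rintro e rfl
    exact exists_wordExponent_eq e
  -- Without words of length `d` there are no monomials of degree `d`; otherwise `x₀` is the default
  -- value of the choice function `c`.
  rcases isEmpty_or_nonempty (Fin d → Y) with hE | ⟨⟨x₀⟩⟩
  · refine ⟨fun _ => 0, fun x => hE.elim x, fun f => ?_⟩
    rw [Finset.univ_eq_empty, Finset.sum_empty, eq_comm]
    refine Finset.sum_eq_zero fun e he => ?_
    exact hE.elim (hw e (Finset.mem_filter.1 he).2).choose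
  have hc : ∀ e : Y →₀ ℕ, ∃ x : Fin d → Y, e.degree = d → wordExponent x = e := by
    intro e
    by_cases h : e.degree = d
    · exact (hw e h).imp fun x hx _ => hx
    · exact ⟨x₀, fun h' => absurd h' h⟩
  choose c hc using hc
  -- Only the selected word of each monomial gets weight, so no multinomial factor appears and the
  -- coefficient bound is kept.
  refine ⟨fun x => if c (wordExponent x) = x then r.coeff (wordExponent x) else 0, ?_, ?_⟩
  · intro x
    by_cases h : c (wordExponent x) = x <;> simp [h]
  · intro f
    symm
    refine Finset.sum_of_injOn c ?_ (fun _ _ => Finset.mem_univ _) ?_ ?_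
    · intro e he e' he' hee
      simp only [Finset.coe_filter, Set.mem_ofPred_eq] at he he'
      rw [← hc e he.2, ← hc e' he'.2, hee]
    · intro x _ hx
      by_cases h : c (wordExponent x) = x
      · simp only [if_pos h]
        by_contra hne
        refine hx ⟨wordExponent x, ?_, h⟩
        simp only [Finset.coe_filter, Set.mem_ofPred_eq, MvPolynomial.mem_support_iff]
        exact ⟨left_ne_zero_of_mul hne, degree_wordExponent x⟩
      · simp [h]
    · intro e he
      have := hc e (Finset.mem_filter.1 he).2
      simp only [this, if_true]
      rw [← prod_wordExponent, this]

/-- The set of polynomial local functions with explicit constants. -/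
def polynomialLocalFamily (T A D : ℕ) (B : ℝ) : FnFamily T := fun n =>
  {x | ∃ N : Fin n → Finset (Fin n), BoundedNeighborhoods A N ∧
    ∃ r : ∀ i : Fin n, MvPolynomial (N i × Fin x.1) ℝ,
      (∀ z i, x.2 z i = MvPolynomial.eval (fun y => rowsOf (N i) z y.1 y.2) (r i)) ∧
      ∀ i, (r i).totalDegree ≤ D ∧ ∀ e, |(r i).coeff e| ≤ B}

lemma isPolynomialLocal_polynomialLocalFamily {T A D : ℕ} {B : ℝ} (hA : 0 < A) (hD : 0 < D)
    (hB : 0 < B) : IsPolynomialLocal (polynomialLocalFamily T A D B) :=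
  ⟨A, D, B, hA, hD, hB, fun _ _ _ _ h => h⟩

/-- Renaming along an injection puts the polynomials of all coordinates in common variables, as the
tensor entries require; locality survives as a condition on `vars`. -/
lemma exists_globalPolynomial {n t D : ℕ} {B : ℝ} (hB : 0 < B) {S : Finset (Fin n)}
    (r : MvPolynomial (S × Fin t) ℝ) (hD : r.totalDegree ≤ D) (hr : ∀ e, |r.coeff e| ≤ B) :
    ∃ R : MvPolynomial (Fin n × Fin t) ℝ, R.totalDegree ≤ D ∧ (∀ e, |R.coeff e| ≤ B) ∧
      (∀ x ∈ R.vars, x.1 ∈ S) ∧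
      ∀ z : RMat n t, MvPolynomial.eval (fun y => rowsOf S z y.1 y.2) r =
        MvPolynomial.eval (fun y => z y.1 y.2) R := by
  classical
  let ι : S × Fin t → Fin n × Fin t := fun y => (y.1, y.2)
  have hι : Function.Injective ι := by
    rintro ⟨a, s⟩ ⟨b, s'⟩ h
    simp only [ι, Prod.mk.injEq] at h
    exact Prod.ext (Subtype.ext h.1) h.2
  refine ⟨MvPolynomial.rename ι r, (MvPolynomial.totalDegree_rename_le _ _).trans hD, ?_, ?_, ?_⟩
  · intro e
    by_cases h : ∃ u, Finsupp.mapDomain ι u = e ∧ r.coeff u ≠ 0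
    · obtain ⟨u, rfl, -⟩ := h
      rw [MvPolynomial.coeff_rename_mapDomain _ hι]
      exact hr u
    · rw [MvPolynomial.coeff_rename_eq_zero]
      · simpa using hB.le
      · intro u hu
        by_contra h'
        exact h ⟨u, hu, h'⟩
  · intro x hx
    obtain ⟨y, -, rfl⟩ := MvPolynomial.mem_vars_rename _ _ hx
    exact y.1.2
  · intro z
    rw [MvPolynomial.eval_rename]
    rfl

/-- These tuples contain the supports of the tensors in (a), the last index being the output row. If
the last index is fixed, the others range over one neighborhood; if another is fixed to `v`, the
last is one of the at most `A` rows whose neighborhood contains `v`. -/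
lemma card_filter_tuples_le {n d A : ℕ} {N : Fin n → Finset (Fin n)}
    (hN : BoundedNeighborhoods A N) (a : Fin (d + 1)) (v : Fin n) :
    (Finset.univ.filter fun i : Fin (d + 1) → Fin n =>
      i a = v ∧ ∀ b : Fin d, i b.castSucc ∈ N (i (Fin.last d))).card ≤ (A + 1) ^ (d + 1) := by
  classical
  -- the possible values of the last index
  let J : Finset (Fin n) := insert v (Finset.univ.filter fun j => v ∈ N j)
  have hJ : J.card ≤ A + 1 := (Finset.card_insert_le _ _).trans (Nat.add_le_add_right (hN v).2 1)
  have hsub : (Finset.univ.filter fun i : Fin (d + 1) → Fin n =>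
      i a = v ∧ ∀ b : Fin d, i b.castSucc ∈ N (i (Fin.last d))) ⊆
      J.biUnion fun j => (Fintype.piFinset fun _ : Fin d => N j).image
        fun x => (Fin.snoc x j : Fin (d + 1) → Fin n) := by
    intro i hi
    simp only [Finset.mem_filter, Finset.mem_univ, true_and] at hi
    refine Finset.mem_biUnion.2 ⟨i (Fin.last d), ?_, Finset.mem_image.2
      ⟨fun b => i b.castSucc, ?_, ?_⟩⟩
    · rcases Fin.eq_castSucc_or_eq_last a with ⟨b, rfl⟩ | rfl
      · refine Finset.mem_insert_of_mem ?_
        simpa [← hi.1] using hi.2 b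
      · simp [J, hi.1]
    · simpa using hi.2
    · exact Fin.snoc_init_self i
  calc _ ≤ _ := Finset.card_le_card hsub
    _ ≤ J.card * (A + 1) ^ d := Finset.card_biUnion_le_card_mul _ _ _ fun j _ => by
        refine Finset.card_image_le.trans ?_
        rw [Fintype.card_piFinset, Finset.prod_const, Finset.card_univ, Fintype.card_fin]
        exact Nat.pow_le_pow_left ((hN j).1.trans (Nat.le_succ A)) d
    _ ≤ (A + 1) * (A + 1) ^ d := Nat.mul_le_mul_right _ hJ
    _ = (A + 1) ^ (d + 1) := by ring

/-- A word in (row, column) pairs is a word of rows together with a word of columns `σ`, so summing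
over `σ` recovers all words. -/
lemma sum_contract_eq {n t d : ℕ} (u : Fin n → (Fin d → Fin n × Fin t) → ℝ) (z : RMat n t)
    (j : Fin n) :
    ∑ σ : Fin d → Fin t, contract (fun i : Fin (d + 1) → Fin n =>
        u (i (Fin.last d)) fun a => (i a.castSucc, σ a)) z σ j =
      ∑ x : Fin d → Fin n × Fin t, u j x * ∏ a, z (x a).1 (x a).2 := by
  simp only [contract, Fin.snoc_last, Fin.snoc_castSucc]
  rw [Finset.sum_comm, ← Fintype.sum_prod_type']
  exact (Fintype.sum_equiv (Equiv.arrowProdEquivProdArrow (Fin d) (fun _ => Fin n)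
    (fun _ => Fin t)) _ _ fun x => rfl).symm

lemma eval_eq_sum_degree {Y : Type*} (r : MvPolynomial Y ℝ) {D : ℕ} (hD : r.totalDegree ≤ D)
    (f : Y → ℝ) :
    MvPolynomial.eval f r = r.coeff 0 + ∑ d ∈ Finset.Icc 1 D,
      ∑ e ∈ r.support.filter (fun e => e.degree = d), r.coeff e * e.prod fun y c => f y ^ c := by
  classical
  have h0 : ∑ e ∈ r.support.filter (fun e => e.degree = 0),
      r.coeff e * (e.prod fun y c => f y ^ c) = r.coeff 0 := by
    rw [Finset.sum_subset (s₂ := {0})]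
    · simp
    · intro e he
      simpa [Finsupp.degree_eq_zero_iff] using (Finset.mem_filter.1 he).2
    · intro e he hne
      rw [Finset.mem_singleton.1 he] at hne ⊢
      simpa using hne
  rw [← h0]
  have : Finset.Icc 1 D = (Finset.range (D + 1)).erase 0 := by
    ext d; simp; omega
  rw [this, Finset.add_sum_erase _ (fun d => ∑ e ∈ r.support.filter (fun e => e.degree = d),
    r.coeff e * e.prod fun y c => f y ^ c) (by simp), Finset.sum_fiberwise_of_maps_to]
  · rw [MvPolynomial.eval_eq]
    rfl
  · intro e he
    have := (MvPolynomial.le_totalDegree he).trans hD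
    simp only [Finset.mem_range]
    exact Nat.lt_succ_of_le this

theorem IsPolynomialLocal.bcpRepresentable {T : ℕ} {P : FnFamily T} (hP : IsPolynomialLocal P) :
    BCPRepresentable P := by
  classical
  obtain ⟨A, D, B, hA, hD, hB, hP⟩ := hP
  refine ⟨D, fun n k => {U | SparseTensor B ((A + 1) ^ (D + 1)) U},
    satisfiesBCP_sparseTensor _ B hB _, ?_⟩
  intro n hn t p hp
  obtain ⟨N, hN, r, hpr, hr⟩ := hP n hn t p hp
  choose R hRD hRB hRv hRe using fun i => exists_globalPolynomial hB (r i) (hr i).1 (hr i).2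
  choose u hu hus using fun (j : Fin n) (d : ℕ) => exists_word_coefficients (R j) d
  have hubd : ∀ j d x, |u j d x| ≤ B := by
    intro j d x
    rcases hu j d x with h | h
    · simpa [h] using hB.le
    · rw [h]; exact hRB j _
  -- A nonzero weight is a true coefficient of `R j`, so every letter of the word is a variable of
  -- `R j`: this is the sparsity of the tensors.
  have hunz : ∀ j d x, u j d x ≠ 0 → ∀ a, (x a).1 ∈ N j := by
    intro j d x hx a
    refine hRv j _ (MvPolynomial.mem_vars_iff_mem_support _ |>.2 ⟨wordExponent x, ?_, ?_⟩)
    · rcases hu j d x with h | h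
      · exact absurd h hx
      · rwa [MvPolynomial.mem_support_iff, ← h]
    · rw [Finsupp.mem_support_iff, wordExponent, Finsupp.finsetSum_apply]
      refine (Finset.sum_pos' (fun _ _ => Nat.zero_le _) ⟨a, Finset.mem_univ a, ?_⟩).ne'
      simp
  refine ⟨fun i => (R (i 0)).coeff 0, ?_, fun d σ i => u (i (Fin.last d)) d
    fun a => (i a.castSucc, σ a), ?_, ?_⟩
  · refine ⟨fun i => hRB _ _, fun a v => ?_⟩
    have h1 := card_filter_tuples_le (d := 0) hN a v
    refine (Finset.card_le_card ?_).trans (h1.trans (Nat.pow_le_pow_right (by omega) (by omega)))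
    intro i hi
    simp only [Finset.mem_filter, Finset.mem_univ, true_and] at hi ⊢
    exact ⟨hi.1, fun b => b.elim0⟩
  · intro d hd σ
    refine ⟨fun i => hubd _ _ _, fun a v => ?_⟩
    have h1 := card_filter_tuples_le (d := d) hN a v
    refine (Finset.card_le_card ?_).trans (h1.trans (Nat.pow_le_pow_right (by omega)
      (by have := (Finset.mem_Icc.1 hd).2; omega)))
    intro i hi
    simp only [Finset.mem_filter, Finset.mem_univ, true_and] at hi ⊢
    exact ⟨hi.1, fun b => hunz _ _ _ hi.2 b⟩
  · intro z j
    rw [hpr, hRe, eval_eq_sum_degree _ (hRD j)]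
    congr 1
    refine Finset.sum_congr rfl fun d _ => ?_
    rw [sum_contract_eq (fun j => u j d) z j, hus j d fun x => z x.1 x.2]

/-! ### Taylor polynomials of the sine -/

/-- The derivative of the remainder of order `k + 1` is `c` times that of order `k`; induct from
`‖exp (c x)‖ = 1` on the imaginary axis. Both `c = I` and `c = -I` are used, the latter for negative
arguments of the sine. -/
lemma norm_exp_sub_taylor_le {c : ℂ} (hc : c.re = 0) (hc1 : ‖c‖ = 1) (k : ℕ) :
    ∀ x : ℝ, 0 ≤ x →
      ‖Complex.exp (c * x) - ∑ i ∈ Finset.range k, (c * x) ^ i / (i.factorial : ℂ)‖ ≤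
        x ^ k / k.factorial := by
  have hexp : ∀ x : ℝ, ‖Complex.exp (c * x)‖ = 1 := fun x => by
    rw [Complex.norm_exp]; simp [hc]
  induction k with
  | zero => intro x _; simp [hexp]
  | succ k ih =>
    intro x hx
    have hderiv : ∀ y : ℝ, HasDerivAt
        (fun y : ℝ => Complex.exp (c * y) -
          ∑ i ∈ Finset.range (k + 1), (c * y) ^ i / (i.factorial : ℂ))
        (c * (Complex.exp (c * y) - ∑ i ∈ Finset.range k, (c * y) ^ i / (i.factorial : ℂ))) y := by
      intro y
      have h1 : HasDerivAt (fun y : ℝ => c * (y : ℂ)) c y := by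
        simpa using (Complex.ofRealCLM.hasDerivAt (x := y)).const_mul c
      have h2 := h1.cexp
      have h3 : HasDerivAt (fun y : ℝ => ∑ i ∈ Finset.range (k + 1),
          (c * y) ^ i / (i.factorial : ℂ))
          (∑ i ∈ Finset.range (k + 1), (i * (c * y) ^ (i - 1) * c) / (i.factorial : ℂ)) y :=
        HasDerivAt.fun_sum (A := fun i (y : ℝ) => (c * (y : ℂ)) ^ i / (i.factorial : ℂ))
          fun i _ => (h1.pow i).div_const _
      refine (h2.sub h3).congr_deriv ?_
      rw [Finset.sum_range_succ', mul_sub, Finset.mul_sum, mul_comm c (Complex.exp _)]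
      simp only [Nat.cast_zero, zero_mul, zero_div, add_zero]
      congr 1
      refine Finset.sum_congr rfl fun i _ => ?_
      rw [Nat.factorial_succ]
      have : ((i : ℂ) + 1) ≠ 0 := by exact_mod_cast Nat.succ_ne_zero i
      have h' : (i.factorial : ℂ) ≠ 0 := by exact_mod_cast i.factorial_ne_zero
      push_cast
      field_simp
    refine image_norm_le_of_norm_deriv_right_le_deriv_boundary (a := 0) (b := x)
      (B := fun y => y ^ (k + 1) / (k + 1).factorial) (B' := fun y => y ^ k / k.factorial)
      (fun y _ => (hderiv y).continuousAt.continuousWithinAt)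
      (fun y _ => (hderiv y).hasDerivWithinAt) ?_ ?_ ?_ ⟨hx, le_rfl⟩
    · simp [Finset.sum_range_succ']
    · intro y
      refine ((hasDerivAt_pow (k + 1) y).div_const _).congr_deriv ?_
      rw [Nat.factorial_succ]
      have : ((k : ℝ) + 1) ≠ 0 := by positivity
      push_cast
      field_simp
    · intro y hy
      rw [norm_mul, hc1, one_mul]
      exact ih y hy.1

/-- The Taylor polynomial of the sine at `0`, of degree less than `k`. -/
noncomputable def sinTaylor (k : ℕ) : Polynomial ℝ :=
  ∑ i ∈ Finset.range k, Polynomial.C ((Complex.I ^ i).im / i.factorial) * Polynomial.X ^ i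

lemma abs_sin_sub_sinTaylor_le (k : ℕ) (x : ℝ) :
    |Real.sin x - (sinTaylor k).eval x| ≤ |x| ^ k / k.factorial := by
  have key : ∀ c : ℂ, c.re = 0 → ‖c‖ = 1 → c * (|x| : ℝ) = Complex.I * x →
      |Real.sin x - (sinTaylor k).eval x| ≤ |x| ^ k / k.factorial := by
    intro c hc hc1 hcx
    have h := norm_exp_sub_taylor_le hc hc1 k |x| (abs_nonneg x)
    refine le_trans ?_ h
    refine le_trans (le_of_eq ?_) (Complex.abs_im_le_norm _)
    rw [hcx, Complex.sub_im, mul_comm Complex.I, Complex.exp_ofReal_mul_I_im, Complex.im_sum,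
      sinTaylor, Polynomial.eval_finsetSum]
    congr 2
    refine Finset.sum_congr rfl fun i _ => ?_
    have : ((x : ℂ) * Complex.I) ^ i / (i.factorial : ℂ) =
        ((x ^ i / i.factorial : ℝ) : ℂ) * Complex.I ^ i := by
      push_cast; ring
    rw [this, Complex.im_ofReal_mul, Polynomial.eval_mul, Polynomial.eval_C, Polynomial.eval_pow,
      Polynomial.eval_X]
    ring
  rcases le_total 0 x with h | h
  · exact key Complex.I (by simp) (by simp) (by rw [abs_of_nonneg h])
  · exact key (-Complex.I) (by simp) (by simp) (by rw [abs_of_nonpos h]; push_cast; ring)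

/-- After rescaling, replacing `x` by `R sin (x / R)` costs at most `|x|³ / (6 R²)`, small on
average for large `R`. -/
lemma abs_sub_sin_le (x : ℝ) : |x - Real.sin x| ≤ |x| ^ 3 / 6 := by
  have h := abs_sin_sub_sinTaylor_le 3 x
  have h3 : (sinTaylor 3).eval x = x := by
    simp [sinTaylor, Finset.sum_range_succ, pow_succ]
  rw [h3, abs_sub_comm] at h
  simpa [Nat.factorial] using h

/-! ### Perturbation of products -/

/-- Telescoping one factor at a time; the form `(1 + e) ^ card - 1` reproduces itself in the
induction. -/
lemma abs_prod_sub_prod_le {ι : Type*} (I : Finset ι) (a b : ι → ℝ) {e : ℝ}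
    (ha : ∀ i ∈ I, |a i| ≤ 1) (hab : ∀ i ∈ I, |b i - a i| ≤ e) :
    |∏ i ∈ I, b i - ∏ i ∈ I, a i| ≤ (1 + e) ^ I.card - 1 := by
  classical
  induction I using Finset.induction_on with
  | empty => simp
  | insert i I hi ih =>
    rw [Finset.prod_insert hi, Finset.prod_insert hi, Finset.card_insert_of_notMem hi]
    have ih' := ih (fun j hj => ha j (Finset.mem_insert_of_mem hj))
      (fun j hj => hab j (Finset.mem_insert_of_mem hj))
    have hai := ha i (Finset.mem_insert_self _ _)
    have hbi := hab i (Finset.mem_insert_self _ _)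
    have he : 0 ≤ e := (abs_nonneg _).trans hbi
    have hA : |∏ j ∈ I, a j| ≤ 1 := by
      rw [Finset.abs_prod]
      exact Finset.prod_le_one (fun _ _ => abs_nonneg _)
        fun j hj => ha j (Finset.mem_insert_of_mem hj)
    have hb : |b i| ≤ 1 + e := by
      have := abs_add_le (a i) (b i - a i)
      rw [add_sub_cancel] at this
      linarith
    have h1 : b i * ∏ j ∈ I, b j - a i * ∏ j ∈ I, a j =
        b i * (∏ j ∈ I, b j - ∏ j ∈ I, a j) + (b i - a i) * ∏ j ∈ I, a j := by ring
    rw [h1]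
    calc _ ≤ |b i| * |∏ j ∈ I, b j - ∏ j ∈ I, a j| + |b i - a i| * |∏ j ∈ I, a j| := by
          rw [← abs_mul, ← abs_mul]; exact abs_add_le _ _
      _ ≤ (1 + e) * ((1 + e) ^ I.card - 1) + e * 1 := by gcongr
      _ = _ := by ring

/-- The linear term rules for `e ≤ 1`, the top power for `e ≥ 1`. Keeping just `e` and `e ^ D`
leaves two moments to control. -/
lemma one_add_pow_sub_one_le {e : ℝ} (he : 0 ≤ e) {d D : ℕ} (hd : d ≤ D) :
    (1 + e) ^ d - 1 ≤ 2 ^ D * (e + e ^ D) := by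
  rcases le_total e 1 with h | h
  · have h1 : (1 + e) ^ d - 1 ≤ (2 ^ d - 1) * e := by
      clear hd
      induction d with
      | zero => simp
      | succ d ih =>
        have h2 : (0 : ℝ) ≤ 2 ^ d - 1 := sub_nonneg.2 (one_le_pow₀ one_le_two)
        calc (1 + e) ^ (d + 1) - 1 = (1 + e) * ((1 + e) ^ d - 1) + e := by ring
          _ ≤ (1 + 1) * ((2 ^ d - 1) * e) + e := by
              refine add_le_add_left ?_ e
              refine (mul_le_mul_of_nonneg_left ih (by positivity)).trans ?_
              exact mul_le_mul_of_nonneg_right (by linarith) (mul_nonneg h2 he)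
          _ = _ := by ring
    have h3 : (2 : ℝ) ^ d ≤ 2 ^ D := pow_le_pow_right₀ one_le_two hd
    have h4 : (0 : ℝ) ≤ 2 ^ D * e ^ D := by positivity
    nlinarith [mul_le_mul_of_nonneg_right h3 he]
  · have h1 : (1 + e) ^ d ≤ (2 * e) ^ D :=
      (pow_le_pow_left₀ (by positivity) (by linarith) d).trans
        (pow_le_pow_right₀ (by linarith) hd)
    rw [mul_pow] at h1
    have h2 : (0 : ℝ) ≤ 2 ^ D * e := by positivity
    linarith

lemma abs_eval_sub_eval_le (q : Polynomial ℝ) {K : ℝ} {d : ℕ}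
    (hK : ∑ i ∈ Finset.range (q.natDegree + 1), |q.coeff i| ≤ K)
    (hd : q.natDegree ≤ d) {a b e : ℝ} (ha : |a| ≤ 1) (hab : |b - a| ≤ e) :
    |q.eval b - q.eval a| ≤ K * ((1 + e) ^ d - 1) := by
  have he : 0 ≤ e := (abs_nonneg _).trans hab
  have h1 : (1 : ℝ) ≤ (1 + e) ^ d := one_le_pow₀ (by linarith)
  rw [Polynomial.eval_eq_sum_range, Polynomial.eval_eq_sum_range, ← Finset.sum_sub_distrib]
  refine (Finset.abs_sum_le_sum_abs _ _).trans
    (le_trans ?_ (mul_le_mul_of_nonneg_right hK (by linarith)))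
  rw [Finset.sum_mul]
  refine Finset.sum_le_sum fun i hi => ?_
  rw [← mul_sub, abs_mul]
  refine mul_le_mul_of_nonneg_left ?_ (abs_nonneg _)
  have := abs_prod_sub_prod_le (Finset.range i) (fun _ => a) (fun _ => b)
    (fun _ _ => ha) (fun _ _ => hab)
  simp only [Finset.prod_const, Finset.card_range] at this
  refine this.trans (sub_le_sub_right (pow_le_pow_right₀ (by linarith) ?_) _)
  have := Finset.mem_range.1 hi
  omega

lemma exists_prod_eval_bound {V : Type*} [Fintype V] (W : V → Polynomial ℝ)
    (hW : ∀ j u, |u| ≤ 1 → |(W j).eval u| ≤ 1) (M : ℕ) :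
    ∃ D : ℕ, 1 ≤ D ∧ ∀ (X : Type) [Fintype X], Fintype.card X ≤ M →
      ∀ (a b : X → ℝ) (e : ℝ), 0 ≤ e → (∀ s, |a s| ≤ 1) → (∀ s, |b s - a s| ≤ e) →
      ∀ v : X → V,
        |∏ s, (W (v s)).eval (b s) - ∏ s, (W (v s)).eval (a s)| ≤ 2 ^ D * (e + e ^ D) := by
  -- `K` is a natural number so that Bernoulli's inequality turns `K * ((1 + e) ^ d - 1)` into `(1 +
  -- e) ^ (d * K) - 1`, the shape needed to perturb the product once more.
  obtain ⟨K, hK⟩ : ∃ K : ℕ, ∀ j,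
      ∑ i ∈ Finset.range ((W j).natDegree + 1), |(W j).coeff i| ≤ K := by
    choose K hK using fun j => exists_nat_ge
      (∑ i ∈ Finset.range ((W j).natDegree + 1), |(W j).coeff i|)
    refine ⟨∑ j, K j, fun j => (hK j).trans ?_⟩
    exact_mod_cast Finset.single_le_sum (fun i _ => Nat.zero_le (K i)) (Finset.mem_univ j)
  let d := ∑ j, (W j).natDegree
  have hd : ∀ j, (W j).natDegree ≤ d := fun j =>
    Finset.single_le_sum (f := fun j => (W j).natDegree) (fun i _ => Nat.zero_le _)
      (Finset.mem_univ j)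
  refine ⟨d * K * M + 1, by omega, fun X _ hX a b e he ha hab v => ?_⟩
  have h1 : ∀ s, |(W (v s)).eval (b s) - (W (v s)).eval (a s)| ≤ (1 + e) ^ (d * K) - 1 := by
    intro s
    refine (abs_eval_sub_eval_le _ (hK _) (hd _) (ha s) (hab s)).trans ?_
    have := one_add_mul_le_pow (a := (1 + e) ^ d - 1)
      (by linarith [one_le_pow₀ (n := d) (by linarith : 1 ≤ 1 + e)]) K
    rw [add_sub_cancel, ← pow_mul] at this
    linarith
  have h2 := abs_prod_sub_prod_le Finset.univ (fun s => (W (v s)).eval (a s))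
    (fun s => (W (v s)).eval (b s)) (fun s _ => hW _ _ (ha s)) (fun s _ => h1 s)
  rw [add_sub_cancel, ← pow_mul] at h2
  refine h2.trans (one_add_pow_sub_one_le he (Nat.le_succ_of_le ?_))
  exact Nat.mul_le_mul_left _ hX

/-! ### Multivariate Bernstein approximation on a cube -/

/-- Bernstein polynomials transported to `[-1, 1]`. -/
noncomputable def bernsteinSym (m : ℕ) (j : Fin (m + 1)) : Polynomial ℝ :=
  (bernsteinPolynomial ℝ m j).comp (Polynomial.C (1 / 2) * (Polynomial.X + 1))

/-- The nodes of the Bernstein operator on `[-1, 1]`. -/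
noncomputable def bernsteinNode (m : ℕ) (j : Fin (m + 1)) : ℝ := 2 * ((j : ℕ) / (m : ℝ)) - 1

lemma sum_bernsteinSym_eval (m : ℕ) (u : ℝ) : ∑ j, (bernsteinSym m j).eval u = 1 := by
  have h := congrArg (Polynomial.eval (1 / 2 * (u + 1))) (bernsteinPolynomial.sum ℝ m)
  rw [Polynomial.eval_finsetSum, Finset.sum_range] at h
  simpa [bernsteinSym] using h

lemma bernsteinSym_eval_nonneg (m : ℕ) (j : Fin (m + 1)) {u : ℝ} (hu : |u| ≤ 1) :
    0 ≤ (bernsteinSym m j).eval u := by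
  rw [abs_le] at hu
  have h := bernstein_nonneg (n := m) (ν := j)
    (x := ⟨1 / 2 * (u + 1), by constructor <;> linarith⟩)
  simpa [bernsteinSym, bernstein] using h

lemma abs_bernsteinSym_eval_le_one (m : ℕ) (j : Fin (m + 1)) {u : ℝ} (hu : |u| ≤ 1) :
    |(bernsteinSym m j).eval u| ≤ 1 := by
  rw [abs_of_nonneg (bernsteinSym_eval_nonneg m j hu), ← sum_bernsteinSym_eval m u]
  exact Finset.single_le_sum (f := fun j => (bernsteinSym m j).eval u)
    (fun i _ => bernsteinSym_eval_nonneg m i hu) (Finset.mem_univ j)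

lemma abs_bernsteinNode_le_one (m : ℕ) (j : Fin (m + 1)) : |bernsteinNode m j| ≤ 1 := by
  have h := (bernstein.z j).2
  simp only [bernstein.z, Set.mem_Icc] at h
  rw [abs_le, bernsteinNode]
  constructor <;> linarith

/-- The variance of the Bernstein weights controls the mean displacement through `t ≤ κ + t ^ 2 /
κ`. -/
lemma sum_abs_sub_bernsteinNode_le {m : ℕ} (hm : m ≠ 0) {κ : ℝ} (hκ : 0 < κ) {u : ℝ}
    (hu : |u| ≤ 1) :
    ∑ j, |u - bernsteinNode m j| * (bernsteinSym m j).eval u ≤ κ + 1 / (κ * m) := by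
  have hu' := abs_le.1 hu
  have hv := bernstein.variance hm ⟨1 / 2 * (u + 1), by constructor <;> linarith⟩
  have hm' : (0 : ℝ) < m := by positivity
  have h1 : ∑ j, (u - bernsteinNode m j) ^ 2 * (bernsteinSym m j).eval u ≤ 1 / m := by
    have h2 : ∑ j, (u - bernsteinNode m j) ^ 2 * (bernsteinSym m j).eval u =
        4 * (1 / 2 * (u + 1) * (1 - 1 / 2 * (u + 1)) / m) := by
      rw [← hv, Finset.mul_sum]
      refine Finset.sum_congr rfl fun j _ => ?_
      simp only [bernsteinSym, bernsteinNode, bernstein, bernstein.z, Polynomial.eval_comp,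
        Polynomial.toContinuousMapOn_apply, Polynomial.toContinuousMap_apply]
      simp only [Polynomial.eval_mul, Polynomial.eval_C, Polynomial.eval_add, Polynomial.eval_X,
        Polynomial.eval_one]
      ring
    rw [h2, ← mul_div_assoc]
    refine div_le_div_of_nonneg_right ?_ hm'.le
    nlinarith [sq_nonneg u]
  calc _ ≤ ∑ j, (κ + (u - bernsteinNode m j) ^ 2 / κ) * (bernsteinSym m j).eval u := by
        refine Finset.sum_le_sum fun j _ => mul_le_mul_of_nonneg_right ?_
          (bernsteinSym_eval_nonneg m j hu)
        rw [← sq_abs (u - bernsteinNode m j)]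
        set t := |u - bernsteinNode m j|
        rw [← sub_nonneg]
        have : κ + t ^ 2 / κ - t = ((κ - t) ^ 2 + κ * t) / κ := by field_simp; ring
        rw [this]
        have : 0 ≤ t := abs_nonneg _
        positivity
    _ = κ * ∑ j, (bernsteinSym m j).eval u +
        1 / κ * ∑ j, (u - bernsteinNode m j) ^ 2 * (bernsteinSym m j).eval u := by
        rw [Finset.mul_sum, Finset.mul_sum, ← Finset.sum_add_distrib]
        exact Finset.sum_congr rfl fun j _ => by ring
    _ ≤ κ * 1 + 1 / κ * (1 / m) := by
        rw [sum_bernsteinSym_eval]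
        gcongr
    _ = _ := by rw [mul_one, one_div_mul_one_div]

lemma sum_prod_eq_one {X V : Type*} [Fintype X] [DecidableEq X] [Fintype V] {c : X → V → ℝ}
    (hc : ∀ s, ∑ j, c s j = 1) : ∑ v : X → V, ∏ s, c s (v s) = 1 := by
  rw [← Fintype.piFinset_univ, ← Finset.prod_univ_sum]
  simp [hc]

/-- A weighted average of a function of finitely many variables does not depend on the weights of
the variables that the function ignores. -/
lemma sum_mul_prod_congr_of_dependsOn {X V : Type*} [Fintype X] [DecidableEq X] [Fintype V]
    (S : Set X)
    (G : (X → V) → ℝ) (hG : ∀ v v', (∀ s ∈ S, v s = v' s) → G v = G v')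
    {c c' : X → V → ℝ} (hc : ∀ s, ∑ j, c s j = 1) (hc' : ∀ s, ∑ j, c' s j = 1)
    (h : ∀ s ∈ S, c s = c' s) :
    ∑ v, G v * ∏ s, c s (v s) = ∑ v, G v * ∏ s, c' s (v s) := by
  classical
  have key : ∀ c c' : X → V → ℝ, (∀ s, ∑ j, c' s j = 1) →
      ∑ v, G v * ∏ s, c s (v s) =
        ∑ p : (X → V) × (X → V), G p.1 * ∏ s, (c s (p.1 s) * c' s (p.2 s)) := by
    intro c c' hc'
    rw [Fintype.sum_prod_type]
    refine Finset.sum_congr rfl fun v _ => ?_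
    simp_rw [Finset.prod_mul_distrib, ← Finset.mul_sum]
    rw [sum_prod_eq_one hc', mul_one]
  rw [key c c' hc', key c' c hc]
  -- Both averages are now over independent pairs. Swapping the two components outside `S` exchanges
  -- the weights there and leaves `G` unchanged.
  let f : (X → V) × (X → V) → (X → V) × (X → V) := fun p =>
    (fun s => if s ∈ S then p.1 s else p.2 s, fun s => if s ∈ S then p.2 s else p.1 s)
  have hf : Function.Involutive f := by
    intro p
    ext s <;> by_cases hs : s ∈ S <;> simp [f, hs]
  refine Fintype.sum_equiv hf.toPerm _ _ fun p => ?_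
  change _ = G (f p).1 * ∏ s, (c' s ((f p).1 s) * c s ((f p).2 s))
  rw [hG (f p).1 p.1 fun s hs => by simp [f, hs]]
  congr 1
  refine Finset.prod_congr rfl fun s _ => ?_
  by_cases hs : s ∈ S
  · simp [f, hs, h s hs]
  · simp [f, hs, mul_comm]

/-- The Bernstein polynomial averages `g` over product weights, so the Lipschitz bound reduces the
error to the mean displacement of each coordinate. -/
lemma abs_sub_bernstein_le {X : Type*} [Fintype X] [DecidableEq X] {L R : ℝ} (hL : 0 ≤ L) (hR : 0 ≤ R)
    {g : (X → ℝ) → ℝ} (hg : ∀ x y, |g x - g y| ≤ L * ∑ s, |x s - y s|)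
    {m : ℕ} (hm : m ≠ 0) {κ : ℝ} (hκ : 0 < κ) {a : X → ℝ} (ha : ∀ s, |a s| ≤ 1) :
    |g (fun s => R * a s) - ∑ v : X → Fin (m + 1), g (fun s => R * bernsteinNode m (v s)) *
      ∏ s, (bernsteinSym m (v s)).eval (a s)| ≤
      L * (R * (Fintype.card X * (κ + 1 / (κ * m)))) := by
  have h1 : ∑ v : X → Fin (m + 1), ∏ s, (bernsteinSym m (v s)).eval (a s) = 1 :=
    sum_prod_eq_one (c := fun s j => (bernsteinSym m j).eval (a s))
      fun s => sum_bernsteinSym_eval m (a s)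
  have hnn : ∀ v : X → Fin (m + 1), 0 ≤ ∏ s, (bernsteinSym m (v s)).eval (a s) := fun v =>
    Finset.prod_nonneg fun s _ => bernsteinSym_eval_nonneg m _ (ha s)
  have h2 : ∀ s₀, ∑ v : X → Fin (m + 1), |a s₀ - bernsteinNode m (v s₀)| *
      ∏ s, (bernsteinSym m (v s)).eval (a s) =
      ∑ j, |a s₀ - bernsteinNode m j| * (bernsteinSym m j).eval (a s₀) := by
    intro s₀
    -- Inserting the displacement into the factor at `s₀` only, the sum factorizes and all other
    -- factors are one.
    have := Finset.prod_univ_sum (fun _ : X => (Finset.univ : Finset (Fin (m + 1))))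
      (fun s j => (if s = s₀ then |a s₀ - bernsteinNode m j| else 1) *
        (bernsteinSym m j).eval (a s))
    rw [Fintype.piFinset_univ] at this
    simp_rw [Finset.prod_mul_distrib, Finset.prod_ite_eq' Finset.univ s₀] at this
    simp only [Finset.mem_univ, if_true] at this
    rw [← this, Finset.prod_eq_single s₀]
    · simp
    · intro s _ hs
      simp [hs, sum_bernsteinSym_eval]
    · simp
  calc _ = |∑ v : X → Fin (m + 1), (g (fun s => R * a s) -
          g (fun s => R * bernsteinNode m (v s))) * ∏ s, (bernsteinSym m (v s)).eval (a s)| := by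
        simp_rw [sub_mul]
        rw [Finset.sum_sub_distrib, ← Finset.mul_sum, h1, mul_one]
    _ ≤ ∑ v : X → Fin (m + 1), (L * (R * ∑ s, |a s - bernsteinNode m (v s)|)) *
          ∏ s, (bernsteinSym m (v s)).eval (a s) := by
        refine (Finset.abs_sum_le_sum_abs _ _).trans (Finset.sum_le_sum fun v _ => ?_)
        rw [abs_mul, abs_of_nonneg (hnn v)]
        refine mul_le_mul_of_nonneg_right ((hg _ _).trans (le_of_eq ?_)) (hnn v)
        simp_rw [← mul_sub, abs_mul, abs_of_nonneg hR, Finset.mul_sum]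
    _ = L * (R * ∑ s₀, ∑ v : X → Fin (m + 1), |a s₀ - bernsteinNode m (v s₀)| *
          ∏ s, (bernsteinSym m (v s)).eval (a s)) := by
        rw [Finset.sum_comm]
        simp_rw [← Finset.sum_mul]
        rw [Finset.mul_sum, Finset.mul_sum]
        exact Finset.sum_congr rfl fun v _ => by ring
    _ ≤ L * (R * ∑ s₀ : X, (κ + 1 / (κ * m))) := by
        gcongr with s₀
        rw [h2]
        exact sum_abs_sub_bernsteinNode_le hm hκ (ha s₀)
    _ = _ := by rw [Finset.sum_const, Finset.card_univ, nsmul_eq_mul]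

/-! ### Uniform bounds for Gaussian integrals -/

lemma integrable_polynomial_gaussianReal (q : Polynomial ℝ) (μ : ℝ) (v : NNReal) :
    Integrable (fun u => q.eval u) (gaussianReal μ v) := by
  simp_rw [Polynomial.eval_eq_sum_range]
  refine integrable_finsetSum _ fun i _ => Integrable.const_mul ?_ _
  have h := (memLp_id_gaussianReal (μ := μ) (v := v) i).integrable_norm_pow'
  refine h.mono' (by fun_prop) (Eventually.of_forall fun u => ?_)
  simp

/-- Since `N(0, v)` is the image of `N(0, 1)` under `√v` and `√v ≤ c`, one standard Gaussian
integral bounds all these variances at once. -/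
lemma integral_gaussianReal_le_of_abs_le {f : ℝ → ℝ} (hf : Measurable f) (hf0 : ∀ u, 0 ≤ f u)
    (hmono : ∀ s t, |s| ≤ |t| → f s ≤ f t) {c : ℝ} (hc : 0 ≤ c) {v : NNReal}
    (hv : (v : ℝ) ≤ c ^ 2) (hint : Integrable (fun u => f (c * u)) (gaussianReal 0 1)) :
    ∫ u, f u ∂(gaussianReal 0 v) ≤ ∫ u, f (c * u) ∂(gaussianReal 0 1) := by
  have hmap : gaussianReal 0 v = (gaussianReal 0 1).map (√(v : ℝ) * ·) := by
    rw [gaussianReal_map_const_mul, mul_zero, mul_one]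
    congr 1
    ext
    simp
  rw [hmap, integral_map (by fun_prop) hf.aestronglyMeasurable]
  refine integral_mono_of_nonneg (Eventually.of_forall fun u => hf0 _) hint
    (Eventually.of_forall fun u => hmono _ _ ?_)
  rw [abs_mul, abs_mul, abs_of_nonneg (Real.sqrt_nonneg _), abs_of_nonneg hc]
  exact mul_le_mul_of_nonneg_right (Real.sqrt_le_iff.2 ⟨hc, hv⟩) (abs_nonneg _)

/-- Dominated convergence: `|c u| ^ k / k! ≤ exp |c u|` has Gaussian moments of all orders. This
makes the Taylor error of the sine negligible in mean, though not uniformly in `u`. -/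
lemma tendsto_integral_pow_div_factorial (c : ℝ) {p : ℕ} (hp : 1 ≤ p) :
    Tendsto (fun k : ℕ => ∫ u, (((c * u) ^ k / k.factorial) ^ 2) ^ p ∂(gaussianReal 0 1))
      atTop (𝓝 0) := by
  have h := tendsto_integral_of_dominated_convergence (μ := gaussianReal 0 1)
    (F := fun (k : ℕ) u => (((c * u) ^ k / k.factorial) ^ 2) ^ p) (f := fun _ => (0 : ℝ))
    (fun u => Real.exp ((2 * p * |c|) * |u|)) ?_ ?_ ?_ ?_
  · simpa using h
  · intro k
    exact Measurable.aestronglyMeasurable (by fun_prop)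
  · exact integrable_exp_mul_abs (X := id) (integrable_exp_mul_gaussianReal _)
      (by simpa using integrable_exp_mul_gaussianReal (μ := 0) (v := 1) (-(2 * p * |c|)))
  · intro k
    refine Eventually.of_forall fun u => ?_
    rw [Real.norm_eq_abs, abs_of_nonneg (by positivity), ← sq_abs, abs_div, abs_pow, Nat.abs_cast,
      ← pow_mul]
    refine (pow_le_pow_left₀ (by positivity)
      (Real.pow_div_factorial_le_exp _ (abs_nonneg (c * u)) k) (2 * p)).trans (le_of_eq ?_)
    rw [← Real.exp_nat_mul, abs_mul]
    push_cast
    ring_nf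
  · refine Eventually.of_forall fun u => ?_
    have h1 := ((FloorSemiring.tendsto_pow_div_factorial_atTop (c * u)).pow 2).pow p
    simpa [zero_pow (by omega : p ≠ 0)] using h1

/-! ### A polynomial operator approximating Lipschitz functions -/

lemma exists_dominating_value {X : Type*} [Fintype X] (E : X → ℝ) (hE : ∀ s, 0 ≤ E s) {D : ℕ}
    (hD : 1 ≤ D) :
    ∃ e, 0 ≤ e ∧ (∀ s, E s ≤ e) ∧ (e + e ^ D) ^ 2 ≤ 2 * ∑ s, (E s ^ 2 + (E s ^ 2) ^ D) := by
  rcases isEmpty_or_nonempty X with h | h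
  -- Here `D ≥ 1` matters, as `0 ^ 0 = 1`.
  · refine ⟨0, le_rfl, fun s => h.elim s, ?_⟩
    simp
    omega
  · obtain ⟨s₀, -, hs₀⟩ := Finset.exists_max_image Finset.univ E Finset.univ_nonempty
    refine ⟨E s₀, hE s₀, fun s => hs₀ s (Finset.mem_univ s), ?_⟩
    have h1 : E s₀ ^ 2 + (E s₀ ^ 2) ^ D ≤ ∑ s, (E s ^ 2 + (E s ^ 2) ^ D) :=
      Finset.single_le_sum (f := fun s => E s ^ 2 + (E s ^ 2) ^ D) (fun s _ => by positivity)
        (Finset.mem_univ s₀)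
    have h2 : (E s₀ ^ 2) ^ D = (E s₀ ^ D) ^ 2 := by rw [← pow_mul, ← pow_mul, mul_comm]
    nlinarith [sq_nonneg (E s₀ - E s₀ ^ D)]

/-- The chain is `x`, then `R sin (x / R)`, then Bernstein at the sine, then Bernstein at its Taylor
polynomial. Squaring a sum of three errors gives the factors `3`, with `3 / 36 = 1 / 12` and `3 * 2
= 6`. -/
lemma sq_sub_operator_le {X : Type} [Fintype X] [DecidableEq X] {M : ℕ} (hX : Fintype.card X ≤ M)
    {L R κ δ : ℝ} (hL : 0 < L) (hR : 0 < R) (hκ : 0 < κ) {m k D : ℕ} (hm : m ≠ 0) (hD : 1 ≤ D)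
    (hδ : L * (R * (M * (κ + 1 / (κ * m)))) ≤ δ)
    (hW : ∀ (a b : X → ℝ) (e : ℝ), 0 ≤ e → (∀ s, |a s| ≤ 1) → (∀ s, |b s - a s| ≤ e) →
      ∀ v : X → Fin (m + 1), |∏ s, (bernsteinSym m (v s)).eval (b s) -
        ∏ s, (bernsteinSym m (v s)).eval (a s)| ≤ 2 ^ D * (e + e ^ D))
    {g : (X → ℝ) → ℝ} (hg0 : |g 0| ≤ L) (hg : ∀ x y, |g x - g y| ≤ L * ∑ s, |x s - y s|)
    (x : X → ℝ) :
    (g x - ∑ v : X → Fin (m + 1), g (fun s => R * bernsteinNode m (v s)) *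
      ∏ s, (bernsteinSym m (v s)).eval ((sinTaylor k).eval (x s / R))) ^ 2 ≤
    3 * δ ^ 2 + ∑ s, (L ^ 2 * M / (12 * R ^ 4) * x s ^ 6 +
      6 * ((m + 1) ^ M * (L + L * (M * R)) * 2 ^ D) ^ 2 *
        (((x s / R) ^ k / k.factorial) ^ 2 + (((x s / R) ^ k / k.factorial) ^ 2) ^ D)) := by
  set a : X → ℝ := fun s => Real.sin (x s / R) with ha
  set b : X → ℝ := fun s => (sinTaylor k).eval (x s / R) with hb
  set C : ℝ := (m + 1) ^ M * (L + L * (M * R)) * 2 ^ D with hC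
  have hcard : (Fintype.card X : ℝ) ≤ M := by exact_mod_cast hX
  have ha1 : ∀ s, |a s| ≤ 1 := fun s => Real.abs_sin_le_one _
  obtain ⟨e, he0, hes, hesq⟩ := exists_dominating_value
    (fun s => |x s / R| ^ k / k.factorial) (fun s => by positivity) hD
  have hba : ∀ s, |b s - a s| ≤ e := fun s => by
    rw [abs_sub_comm]
    exact (abs_sin_sub_sinTaylor_le k _).trans (hes s)
  -- the three contributions to the error
  have h1 : (g x - g (fun s => R * a s)) ^ 2 ≤ L ^ 2 * M / (36 * R ^ 4) * ∑ s, x s ^ 6 := by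
    have h11 : |g x - g (fun s => R * a s)| ≤ L * (1 / (6 * R ^ 2) * ∑ s, |x s| ^ 3) := by
      refine (hg _ _).trans (mul_le_mul_of_nonneg_left ?_ hL.le)
      rw [Finset.mul_sum]
      refine Finset.sum_le_sum fun s _ => ?_
      have h111 : x s - R * a s = R * (x s / R - Real.sin (x s / R)) := by
        rw [ha]; field_simp
      rw [h111, abs_mul, abs_of_pos hR]
      refine (mul_le_mul_of_nonneg_left (abs_sub_sin_le _) hR.le).trans (le_of_eq ?_)
      rw [abs_div, abs_of_pos hR]
      field_simp
    have h12 : (∑ s, |x s| ^ 3) ^ 2 ≤ M * ∑ s, x s ^ 6 := by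
      have := sq_sum_le_card_mul_sum_sq (s := (Finset.univ : Finset X)) (f := fun s => |x s| ^ 3)
      refine this.trans ?_
      rw [Finset.card_univ]
      have h6 : ∀ s, (|x s| ^ 3) ^ 2 = x s ^ 6 := fun s => by
        rw [← pow_mul, mul_comm, pow_mul, sq_abs, ← pow_mul]
      simp_rw [h6]
      exact mul_le_mul_of_nonneg_right hcard (Finset.sum_nonneg fun s _ => by positivity)
    rw [← sq_abs]
    calc _ ≤ (L * (1 / (6 * R ^ 2) * ∑ s, |x s| ^ 3)) ^ 2 :=
          pow_le_pow_left₀ (abs_nonneg _) h11 2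
      _ = L ^ 2 / (36 * R ^ 4) * (∑ s, |x s| ^ 3) ^ 2 := by field_simp; ring
      _ ≤ L ^ 2 / (36 * R ^ 4) * (M * ∑ s, x s ^ 6) :=
          mul_le_mul_of_nonneg_left h12 (by positivity)
      _ = _ := by ring
  have h2 : |g (fun s => R * a s) - ∑ v : X → Fin (m + 1),
      g (fun s => R * bernsteinNode m (v s)) * ∏ s, (bernsteinSym m (v s)).eval (a s)| ≤ δ := by
    refine (abs_sub_bernstein_le hL.le hR.le hg hm hκ ha1).trans (le_trans ?_ hδ)
    gcongr
  have hG : ∀ v : X → Fin (m + 1), |g (fun s => R * bernsteinNode m (v s))| ≤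
      L + L * (M * R) := by
    intro v
    have h21 := hg (fun s => R * bernsteinNode m (v s)) 0
    have h22 : ∑ s, |R * bernsteinNode m (v s) - (0 : X → ℝ) s| ≤ M * R := by
      refine (Finset.sum_le_card_nsmul _ _ R fun s _ => ?_).trans ?_
      · rw [Pi.zero_apply, sub_zero, abs_mul, abs_of_pos hR]
        exact mul_le_of_le_one_right hR.le (abs_bernsteinNode_le_one m _)
      · rw [Finset.card_univ, nsmul_eq_mul]
        gcongr
    have h23 := abs_add_le (g (fun s => R * bernsteinNode m (v s)) - g 0) (g 0)
    rw [sub_add_cancel] at h23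
    linarith [mul_le_mul_of_nonneg_left h22 hL.le]
  have h3 : |∑ v : X → Fin (m + 1), g (fun s => R * bernsteinNode m (v s)) *
        ∏ s, (bernsteinSym m (v s)).eval (b s) -
      ∑ v : X → Fin (m + 1), g (fun s => R * bernsteinNode m (v s)) *
        ∏ s, (bernsteinSym m (v s)).eval (a s)| ≤ C * (e + e ^ D) := by
    rw [← Finset.sum_sub_distrib]
    refine (Finset.abs_sum_le_sum_abs _ _).trans ((Finset.sum_le_card_nsmul _ _
      ((L + L * (M * R)) * (2 ^ D * (e + e ^ D))) fun v _ => ?_).trans ?_)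
    · rw [← mul_sub, abs_mul]
      exact mul_le_mul (hG v) (hW a b e he0 ha1 hba v) (abs_nonneg _) (by positivity)
    · rw [nsmul_eq_mul, Finset.card_univ, Fintype.card_fun, Fintype.card_fin, hC]
      push_cast
      have : ((m : ℝ) + 1) ^ Fintype.card X ≤ (m + 1) ^ M :=
        pow_le_pow_right₀ (by linarith [Nat.cast_nonneg (α := ℝ) m]) hX
      calc _ ≤ ((m : ℝ) + 1) ^ M * ((L + L * (M * R)) * (2 ^ D * (e + e ^ D))) :=
            mul_le_mul_of_nonneg_right this (by positivity)
        _ = _ := by ring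
  set Gx := g x
  set Gy := g (fun s => R * a s)
  set Sa := ∑ v : X → Fin (m + 1), g (fun s => R * bernsteinNode m (v s)) *
        ∏ s, (bernsteinSym m (v s)).eval (a s)
  set Sb := ∑ v : X → Fin (m + 1), g (fun s => R * bernsteinNode m (v s)) *
        ∏ s, (bernsteinSym m (v s)).eval (b s)
  have h2' : (Gy - Sa) ^ 2 ≤ δ ^ 2 := by
    rw [← sq_abs]; exact pow_le_pow_left₀ (abs_nonneg _) h2 2
  have h3' : (Sb - Sa) ^ 2 ≤ C ^ 2 * (2 * ∑ s, (((x s / R) ^ k / k.factorial) ^ 2 +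
      (((x s / R) ^ k / k.factorial) ^ 2) ^ D)) := by
    rw [← sq_abs]
    refine (pow_le_pow_left₀ (abs_nonneg _) h3 2).trans ?_
    rw [mul_pow]
    refine mul_le_mul_of_nonneg_left (hesq.trans (le_of_eq ?_)) (sq_nonneg _)
    congr 1
    refine Finset.sum_congr rfl fun s _ => ?_
    have : (|x s / R| ^ k / (k.factorial : ℝ)) ^ 2 = ((x s / R) ^ k / k.factorial) ^ 2 := by
      rw [← sq_abs ((x s / R) ^ k / k.factorial), abs_div (_ ^ k), abs_pow, Nat.abs_cast]
    rw [this]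
  rw [Finset.sum_add_distrib, ← Finset.mul_sum, ← Finset.mul_sum]
  have h4 : L ^ 2 * M / (12 * R ^ 4) * ∑ s, x s ^ 6 =
      3 * (L ^ 2 * M / (36 * R ^ 4) * ∑ s, x s ^ 6) := by
    field_simp; ring
  rw [h4]
  nlinarith [sq_nonneg ((Gx - Gy) - (Gy - Sa)), sq_nonneg ((Gx - Gy) + (Sb - Sa)),
    sq_nonneg ((Gy - Sa) + (Sb - Sa))]

/-- Lipschitz functions of at most `M` variables are approximated by tensor products of
univariate polynomials, with an error dominated by a polynomial of small Gaussian mean. -/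
theorem exists_polynomial_operator (M : ℕ) {L C₀ ε : ℝ} (hL : 0 < L) (hC₀ : 0 < C₀) (hε : 0 < ε) :
    ∃ (m : ℕ) (ν : Fin (m + 1) → ℝ) (β : Fin (m + 1) → Polynomial ℝ) (η : Polynomial ℝ),
      (∀ u, ∑ j, (β j).eval u = 1) ∧ (∀ u, 0 ≤ η.eval u) ∧
      (∀ v : NNReal, (v : ℝ) ≤ C₀ → ∫ u, η.eval u ∂(gaussianReal 0 v) ≤ ε) ∧
      ∀ (X : Type) [Fintype X] [DecidableEq X], Fintype.card X ≤ M → ∀ g : (X → ℝ) → ℝ,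
        |g 0| ≤ L → (∀ x y, |g x - g y| ≤ L * ∑ s, |x s - y s|) → ∀ x : X → ℝ,
          (g x - ∑ v : X → Fin (m + 1), g (fun s => ν (v s)) * ∏ s, (β (v s)).eval (x s)) ^ 2 ≤
            ε + ∑ s, η.eval (x s) := by
  -- Chosen so that `C₀ ≤ c ^ 2`.
  obtain ⟨c, hc⟩ : ∃ c, c = C₀ + 1 := ⟨_, rfl⟩
  have hint : ∀ q : Polynomial ℝ, Integrable (fun u => q.eval u) (gaussianReal 0 1) :=
    fun q => integrable_polynomial_gaussianReal q 0 1
  set K : ℝ := ∫ u, (c * u) ^ 6 ∂(gaussianReal 0 1) with hK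
  have hK0 : 0 ≤ K := integral_nonneg fun u => by positivity
  -- Large enough that the sixth-moment term `c₁ * K` is at most `ε / 2`.
  set R : ℝ := 1 + L ^ 2 * M * K / ε with hR
  have hR1 : 1 ≤ R := le_add_of_nonneg_right (by positivity)
  have hR0 : 0 < R := by linarith
  set δ : ℝ := √(ε / 3) with hδ
  have hδ0 : 0 < δ := Real.sqrt_pos.2 (by positivity)
  have hδ2 : 3 * δ ^ 2 = ε := by rw [hδ, Real.sq_sqrt (by positivity)]; ring
  -- With `m > 1 / κ ^ 2`, the displacement bound is at most `2 κ`, and the Bernstein error at most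
  -- `δ`.
  set κ : ℝ := δ / (2 * (L * R * M + 1)) with hκ
  have hκ0 : 0 < κ := by positivity
  obtain ⟨m, hm⟩ := exists_nat_gt (1 / κ ^ 2)
  have hm0 : (0 : ℝ) < m := lt_trans (by positivity) hm
  have hmne : m ≠ 0 := by rintro rfl; simp at hm0
  have hbern : L * (R * (M * (κ + 1 / (κ * m)))) ≤ δ := by
    have h1 : 1 / (κ * m) ≤ κ := by
      rw [div_lt_iff₀ (by positivity)] at hm
      rw [div_le_iff₀ (by positivity)]
      nlinarith
    have h2 : κ * (2 * (L * R * M + 1)) = δ := div_mul_cancel₀ _ (by positivity)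
    calc _ ≤ L * (R * (M * (κ + κ))) := by gcongr
      _ ≤ κ * (2 * (L * R * M + 1)) := by nlinarith
      _ = δ := h2
  obtain ⟨D, hD, hW⟩ := exists_prod_eval_bound (bernsteinSym m)
    (fun j u hu => abs_bernsteinSym_eval_le_one m j hu) M
  set c₁ : ℝ := L ^ 2 * M / (12 * R ^ 4) with hc₁
  set c₂ : ℝ := 6 * ((m + 1) ^ M * (L + L * (M * R)) * 2 ^ D) ^ 2 with hc₂
  have hc₁0 : 0 ≤ c₁ := by positivity
  have hc₂0 : 0 ≤ c₂ := by positivity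
  have h1 : c₁ * K ≤ ε / 2 := by
    have hR4 : R ≤ R ^ 4 := le_self_pow₀ hR1 (by norm_num)
    have h2 : L ^ 2 * M * K ≤ ε * R := by
      rw [hR, mul_add, mul_div_cancel₀ _ hε.ne']
      linarith
    rw [hc₁, div_mul_eq_mul_div, div_le_iff₀ (by positivity)]
    nlinarith [mul_le_mul_of_nonneg_left hR4 hε.le]
  clear_value c₁ c₂ κ δ R K
  -- The Taylor order `k` comes last: `D` and `c₂` were fixed from the Bernstein polynomials alone,
  -- so there is no circularity.
  have hlim := ((tendsto_integral_pow_div_factorial (c / R) le_rfl).add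
    (tendsto_integral_pow_div_factorial (c / R) hD)).const_mul c₂
  rw [add_zero, mul_zero] at hlim
  obtain ⟨k, hk⟩ := (hlim.eventually (gt_mem_nhds (half_pos hε))).exists
  let E : Polynomial ℝ :=
    Polynomial.C (1 / (R ^ k * k.factorial)) * Polynomial.X ^ k
  let η : Polynomial ℝ := Polynomial.C c₁ * Polynomial.X ^ 6 +
    Polynomial.C c₂ * (E ^ 2 + (E ^ 2) ^ D)
  have hE : ∀ u, E.eval u = (u / R) ^ k / k.factorial := by
    intro u
    simp only [E, Polynomial.eval_mul, Polynomial.eval_C, Polynomial.eval_pow, Polynomial.eval_X]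
    rw [div_pow]
    field_simp
  have hη : ∀ u, η.eval u = c₁ * u ^ 6 + c₂ * (((u / R) ^ k / k.factorial) ^ 2 +
      (((u / R) ^ k / k.factorial) ^ 2) ^ D) := by
    intro u
    simp only [η, Polynomial.eval_add, Polynomial.eval_mul, Polynomial.eval_C, Polynomial.eval_pow,
      Polynomial.eval_X, hE]
  clear_value η
  have hη0 : ∀ u, 0 ≤ η.eval u := fun u => by rw [hη]; positivity
  refine ⟨m, fun j => R * bernsteinNode m j,
    fun j => (bernsteinSym m j).comp ((sinTaylor k).comp (Polynomial.C (1 / R) * Polynomial.X)), η,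
    ?_, hη0, ?_, ?_⟩
  · intro u
    simp_rw [Polynomial.eval_comp]
    exact sum_bernsteinSym_eval m _
  · intro v hv
    refine (integral_gaussianReal_le_of_abs_le (f := fun u => η.eval u) (c := c)
      η.continuous.measurable hη0 ?_ (by rw [hc]; positivity) (by rw [hc]; nlinarith) ?_).trans ?_
    · intro s t hst
      rw [hη, hη]
      have h6 : s ^ 6 ≤ t ^ 6 := by
        have := pow_le_pow_left₀ (abs_nonneg _) hst 6
        rwa [← abs_pow, ← abs_pow, abs_of_nonneg (by positivity : 0 ≤ s ^ 6),
          abs_of_nonneg (by positivity : 0 ≤ t ^ 6)] at this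
      have h2 : ((s / R) ^ k / k.factorial) ^ 2 ≤ ((t / R) ^ k / k.factorial) ^ 2 := by
        rw [sq_le_sq, abs_div, abs_div, abs_pow, abs_pow, abs_div, abs_div]
        refine div_le_div_of_nonneg_right (pow_le_pow_left₀ (by positivity) ?_ k) (abs_nonneg _)
        exact div_le_div_of_nonneg_right hst (abs_nonneg _)
      exact add_le_add (mul_le_mul_of_nonneg_left h6 hc₁0) (mul_le_mul_of_nonneg_left
        (add_le_add h2 (pow_le_pow_left₀ (sq_nonneg _) h2 D)) hc₂0)
    · have := hint (η.comp (Polynomial.C c * Polynomial.X))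
      simpa [Polynomial.eval_comp] using this
    · have hI : ∀ p, Integrable (fun u => (((c / R * u) ^ k / k.factorial) ^ 2) ^ p)
          (gaussianReal 0 1) := by
        intro p
        have := hint (((E ^ 2) ^ p).comp (Polynomial.C c * Polynomial.X))
        refine this.congr (Eventually.of_forall fun u => ?_)
        simp only [Polynomial.eval_comp, Polynomial.eval_pow, hE, Polynomial.eval_mul,
          Polynomial.eval_C, Polynomial.eval_X]
        ring_nf
      have hI6 : Integrable (fun u => (c * u) ^ 6) (gaussianReal 0 1) := by
        have := hint ((Polynomial.C c * Polynomial.X) ^ 6)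
        simpa using this
      have h0 : ∀ u, η.eval (c * u) = c₁ * (c * u) ^ 6 +
          c₂ * ((((c / R * u) ^ k / k.factorial) ^ 2) ^ 1 +
            (((c / R * u) ^ k / k.factorial) ^ 2) ^ D) := by
        intro u
        rw [hη, pow_one, mul_div_right_comm]
      have hadd : Integrable (fun u => (((c / R * u) ^ k / k.factorial) ^ 2) ^ 1 +
          (((c / R * u) ^ k / k.factorial) ^ 2) ^ D) (gaussianReal 0 1) := (hI 1).add (hI D)
      simp_rw [h0]
      rw [integral_add (hI6.const_mul _) (hadd.const_mul _),
        integral_const_mul, integral_const_mul, integral_add (hI 1) (hI D), ← hK]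
      linarith
  · intro X _ _ hX g hg0 hg x
    have := sq_sub_operator_le (k := k) hX hL hR0 hκ0 hmne hD hbern (hW X hX) hg0 hg x
    rw [hδ2, ← hc₁, ← hc₂] at this
    simp_rw [hη]
    refine le_trans (le_of_eq ?_) this
    simp only [Polynomial.eval_comp, Polynomial.eval_mul, Polynomial.eval_C, Polynomial.eval_X,
      one_div_mul_eq_div]

/-! ### The sum of the absolute values of the coefficients -/

/-- The `ℓ¹` norm of the coefficients of a polynomial. -/
noncomputable def coeffSum {σ : Type*} (p : MvPolynomial σ ℝ) : ℝ :=
  ∑ e ∈ p.support, |p.coeff e|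

section coeffSum

variable {σ : Type*}

lemma coeffSum_nonneg (p : MvPolynomial σ ℝ) : 0 ≤ coeffSum p :=
  Finset.sum_nonneg fun _ _ => abs_nonneg _

lemma abs_coeff_le_coeffSum (p : MvPolynomial σ ℝ) (e : σ →₀ ℕ) : |p.coeff e| ≤ coeffSum p := by
  by_cases h : e ∈ p.support
  · exact Finset.single_le_sum (f := fun e => |p.coeff e|) (fun _ _ => abs_nonneg _) h
  · rw [MvPolynomial.notMem_support_iff.1 h, abs_zero]
    exact coeffSum_nonneg p

lemma coeffSum_eq_sum {p : MvPolynomial σ ℝ} {s : Finset (σ →₀ ℕ)} (h : p.support ⊆ s) :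
    coeffSum p = ∑ e ∈ s, |p.coeff e| :=
  Finset.sum_subset h fun e _ he => by rw [MvPolynomial.notMem_support_iff.1 he, abs_zero]

lemma coeffSum_add_le (p q : MvPolynomial σ ℝ) : coeffSum (p + q) ≤ coeffSum p + coeffSum q := by
  classical
  rw [coeffSum_eq_sum MvPolynomial.support_add,
    coeffSum_eq_sum (Finset.subset_union_left (s₁ := p.support) (s₂ := q.support)),
    coeffSum_eq_sum (Finset.subset_union_right (s₁ := p.support) (s₂ := q.support)),
    ← Finset.sum_add_distrib]
  refine Finset.sum_le_sum fun e _ => ?_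
  rw [MvPolynomial.coeff_add]
  exact abs_add_le _ _

lemma coeffSum_monomial_le (e : σ →₀ ℕ) (c : ℝ) : coeffSum (MvPolynomial.monomial e c) ≤ |c| := by
  classical
  rw [coeffSum_eq_sum MvPolynomial.support_monomial_subset]
  simp

lemma coeffSum_C_le (c : ℝ) : coeffSum (MvPolynomial.C c : MvPolynomial σ ℝ) ≤ |c| :=
  coeffSum_monomial_le 0 c

lemma coeffSum_sum_le {ι : Type*} (s : Finset ι) (p : ι → MvPolynomial σ ℝ) :
    coeffSum (∑ i ∈ s, p i) ≤ ∑ i ∈ s, coeffSum (p i) := by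
  classical
  induction s using Finset.induction_on with
  | empty => simp [coeffSum]
  | insert i s hi ih =>
    rw [Finset.sum_insert hi, Finset.sum_insert hi]
    exact (coeffSum_add_le _ _).trans (add_le_add_right ih _)

/-- Submultiplicativity is the reason for using the `ℓ¹` norm, which dominates each single
coefficient, instead of the maximum. -/
lemma coeffSum_mul_le (p q : MvPolynomial σ ℝ) : coeffSum (p * q) ≤ coeffSum p * coeffSum q := by
  conv_lhs => rw [← MvPolynomial.support_sum_monomial_coeff p,
    ← MvPolynomial.support_sum_monomial_coeff q, Finset.sum_mul_sum]
  rw [coeffSum.eq_def p, coeffSum.eq_def q, Finset.sum_mul_sum]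
  refine (coeffSum_sum_le _ _).trans (Finset.sum_le_sum fun a _ =>
    (coeffSum_sum_le _ _).trans (Finset.sum_le_sum fun b _ => ?_))
  rw [MvPolynomial.monomial_mul, ← abs_mul]
  exact coeffSum_monomial_le _ _

lemma coeffSum_prod_le {ι : Type*} (s : Finset ι) (p : ι → MvPolynomial σ ℝ) {b : ℝ}
    (hp : ∀ i ∈ s, coeffSum (p i) ≤ b) : coeffSum (∏ i ∈ s, p i) ≤ b ^ s.card := by
  classical
  induction s using Finset.induction_on with
  | empty => simpa using coeffSum_C_le (σ := σ) 1
  | insert i s hi ih =>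
    rw [Finset.prod_insert hi, Finset.card_insert_of_notMem hi, pow_succ']
    have h1 := hp i (Finset.mem_insert_self _ _)
    exact (coeffSum_mul_le _ _).trans (mul_le_mul h1
      (ih fun j hj => hp j (Finset.mem_insert_of_mem hj)) (coeffSum_nonneg _)
      ((coeffSum_nonneg _).trans h1))

/-- The `ℓ¹` norm of the coefficients of a univariate polynomial. -/
noncomputable def univCoeffSum (q : Polynomial ℝ) : ℝ :=
  ∑ i ∈ Finset.range (q.natDegree + 1), |q.coeff i|

lemma univCoeffSum_nonneg (q : Polynomial ℝ) : 0 ≤ univCoeffSum q :=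
  Finset.sum_nonneg fun _ _ => abs_nonneg _

lemma aeval_X_eq_sum_monomial (q : Polynomial ℝ) (x : σ) :
    Polynomial.aeval (MvPolynomial.X x : MvPolynomial σ ℝ) q =
      ∑ i ∈ Finset.range (q.natDegree + 1),
        MvPolynomial.monomial (Finsupp.single x i) (q.coeff i) := by
  rw [Polynomial.aeval_eq_sum_range]
  refine Finset.sum_congr rfl fun i _ => ?_
  rw [MvPolynomial.X_pow_eq_monomial, MvPolynomial.smul_monomial, smul_eq_mul, mul_one]

lemma coeffSum_aeval_X_le (q : Polynomial ℝ) (x : σ) :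
    coeffSum (Polynomial.aeval (MvPolynomial.X x : MvPolynomial σ ℝ) q) ≤ univCoeffSum q := by
  rw [aeval_X_eq_sum_monomial]
  exact (coeffSum_sum_le _ _).trans (Finset.sum_le_sum fun i _ => coeffSum_monomial_le _ _)

lemma totalDegree_aeval_X_le (q : Polynomial ℝ) (x : σ) :
    (Polynomial.aeval (MvPolynomial.X x : MvPolynomial σ ℝ) q).totalDegree ≤ q.natDegree := by
  rw [aeval_X_eq_sum_monomial]
  refine MvPolynomial.totalDegree_finsetSum_le fun i hi => ?_
  refine (MvPolynomial.totalDegree_monomial_le _ _).trans ?_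
  rw [Finsupp.sum_single_index rfl]
  exact Nat.lt_succ_iff.1 (Finset.mem_range.1 hi)

lemma eval_aeval_X (q : Polynomial ℝ) (x : σ) (f : σ → ℝ) :
    MvPolynomial.eval f (Polynomial.aeval (MvPolynomial.X x : MvPolynomial σ ℝ) q) =
      q.eval (f x) := by
  rw [aeval_X_eq_sum_monomial, map_sum, Polynomial.eval_eq_sum_range]
  refine Finset.sum_congr rfl fun i _ => ?_
  rw [MvPolynomial.eval_monomial, Finsupp.prod_single_index (by simp)]

end coeffSum

/-- The tensor product operator `∑ v, G v ∏ x, β (v x) (X x)`, as a polynomial. -/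
noncomputable def tensorOperatorPoly {X : Type*} [Fintype X] [DecidableEq X] {m : ℕ}
    (β : Fin (m + 1) → Polynomial ℝ) (G : (X → Fin (m + 1)) → ℝ) : MvPolynomial X ℝ :=
  ∑ v : X → Fin (m + 1), MvPolynomial.C (G v) *
    ∏ x, Polynomial.aeval (MvPolynomial.X x : MvPolynomial X ℝ) (β (v x))

section tensorOperatorPoly

variable {X : Type*} [Fintype X] [DecidableEq X] {m M : ℕ} (β : Fin (m + 1) → Polynomial ℝ)
  (G : (X → Fin (m + 1)) → ℝ)

lemma eval_tensorOperatorPoly (f : X → ℝ) :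
    MvPolynomial.eval f (tensorOperatorPoly β G) =
      ∑ v : X → Fin (m + 1), G v * ∏ x, (β (v x)).eval (f x) := by
  simp only [tensorOperatorPoly, map_sum, map_mul, map_prod, MvPolynomial.eval_C, eval_aeval_X]

lemma totalDegree_tensorOperatorPoly_le (hX : Fintype.card X ≤ M) :
    (tensorOperatorPoly β G).totalDegree ≤ M * ∑ j, (β j).natDegree := by
  refine MvPolynomial.totalDegree_finsetSum_le fun v _ => ?_
  refine (MvPolynomial.totalDegree_mul _ _).trans ?_
  rw [MvPolynomial.totalDegree_C, zero_add]
  refine (MvPolynomial.totalDegree_finsetProd _ _).trans ((Finset.sum_le_card_nsmul _ _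
    (∑ j, (β j).natDegree) fun x _ => ?_).trans ?_)
  · exact (totalDegree_aeval_X_le _ _).trans (Finset.single_le_sum
      (f := fun j => (β j).natDegree) (fun _ _ => Nat.zero_le _) (Finset.mem_univ (v x)))
  · rw [Finset.card_univ, smul_eq_mul]
    exact Nat.mul_le_mul_right _ hX

lemma coeffSum_tensorOperatorPoly_le (hX : Fintype.card X ≤ M) {g : ℝ} (hg : 0 ≤ g)
    (hG : ∀ v, |G v| ≤ g) :
    coeffSum (tensorOperatorPoly β G) ≤
      (m + 1) ^ M * (g * (1 + ∑ j, univCoeffSum (β j)) ^ M) := by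
  have hb : 1 ≤ 1 + ∑ j, univCoeffSum (β j) :=
    le_add_of_nonneg_right (Finset.sum_nonneg fun j _ => univCoeffSum_nonneg _)
  refine (coeffSum_sum_le _ _).trans ((Finset.sum_le_card_nsmul _ _
    (g * (1 + ∑ j, univCoeffSum (β j)) ^ M) fun v _ => ?_).trans ?_)
  · refine (coeffSum_mul_le _ _).trans (mul_le_mul ((coeffSum_C_le _).trans (hG v)) ?_
      (coeffSum_nonneg _) hg)
    refine (coeffSum_prod_le _ _ (b := 1 + ∑ j, univCoeffSum (β j)) fun x _ => ?_).trans
      (pow_le_pow_right₀ hb (by rwa [Finset.card_univ]))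
    refine (coeffSum_aeval_X_le _ _).trans (le_add_of_nonneg_of_le zero_le_one ?_)
    exact Finset.single_le_sum (f := fun j => univCoeffSum (β j))
      (fun j _ => univCoeffSum_nonneg _) (Finset.mem_univ (v x))
  · rw [nsmul_eq_mul, Finset.card_univ, Fintype.card_fun, Fintype.card_fin]
    push_cast
    refine mul_le_mul_of_nonneg_right ?_ (by positivity)
    exact pow_le_pow_right₀ (by linarith [Nat.cast_nonneg (α := ℝ) m]) hX

end tensorOperatorPoly

/-! ### Gaussian inputs -/

/-- The error majorant is a sum of univariate polynomials in single entries, so these scalar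
marginals determine its mean. -/
lemma measurePreserving_gaussianRows_apply {n t : ℕ} {Sig : Matrix (Fin t) (Fin t) ℝ}
    (hS : Sig.PosSemidef) (i : Fin n) (s : Fin t) :
    MeasurePreserving (fun z : RMat n t => z i s) (gaussianRows n Sig)
      (gaussianReal 0 (Sig s s).toNNReal) := by
  have h1 : MeasurePreserving (fun z : RMat n t => z i) (gaussianRows n Sig)
      ((multivariateGaussian (0 : EuclideanSpace ℝ (Fin t)) Sig).map WithLp.ofLp) := by
    have : IsProbabilityMeasure
        ((multivariateGaussian (0 : EuclideanSpace ℝ (Fin t)) Sig).map WithLp.ofLp) :=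
      Measure.isProbabilityMeasure_map (by fun_prop)
    exact measurePreserving_eval (fun _ : Fin n =>
      (multivariateGaussian (0 : EuclideanSpace ℝ (Fin t)) Sig).map WithLp.ofLp) i
  refine ⟨by fun_prop, ?_⟩
  have h2 := (measurePreserving_eval_multivariateGaussian (μ := 0) hS (i := s)).map_eq
  have h3 : (fun z : RMat n t => z i s) = (fun y : Fin t → ℝ => y s) ∘ fun z => z i := rfl
  rw [h3, ← Measure.map_map (by fun_prop) (by fun_prop), h1.map_eq,
    Measure.map_map (by fun_prop) (by fun_prop)]
  exact h2

lemma IsCovBelow.diag_le {t : ℕ} {C₀ : ℝ} {Sig : Matrix (Fin t) (Fin t) ℝ}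
    (h : IsCovBelow C₀ Sig) (s : Fin t) : Sig s s ≤ C₀ := by
  have h1 := (Matrix.toEuclideanCLM (n := Fin t) (𝕜 := ℝ) Sig).le_opNorm
    (EuclideanSpace.single s 1)
  have h2 := PiLp.norm_apply_le
    (Matrix.toEuclideanCLM (n := Fin t) (𝕜 := ℝ) Sig (EuclideanSpace.single s 1)) s
  have h3 : (Matrix.toEuclideanCLM (n := Fin t) (𝕜 := ℝ) Sig (EuclideanSpace.single s 1)) s =
      Sig s s := by
    rw [Matrix.ofLp_toEuclideanCLM]
    simp
  rw [h3] at h2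
  simp only [PiLp.norm_single, norm_one, mul_one] at h1
  exact (le_abs_self _).trans (h2.trans (h1.trans h.2.le))

/-! ### Lipschitz local functions are BCP-approximable -/

lemma BCPRepresentable.mono {T : ℕ} {P P' : FnFamily T} (h : BCPRepresentable P)
    (hP : ∀ n, 1 ≤ n → P' n ⊆ P n) : BCPRepresentable P' := by
  obtain ⟨D, 𝒯, h𝒯, hrep⟩ := h
  exact ⟨D, 𝒯, h𝒯, fun n hn t p hp => hrep n hn t p (hP n hn hp)⟩

lemma isPolyFn_of_mem_polynomialLocalFamily {T A D n : ℕ} {B : ℝ} (hB : 0 < B) {t : Fin (T + 1)}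
    {p : VecFn n t} (h : ⟨t, p⟩ ∈ polynomialLocalFamily T A D B n) : IsPolyFn D p := by
  obtain ⟨N, -, r, hr, hb⟩ := h
  intro i
  obtain ⟨R, hR, -, -, hRe⟩ := exists_globalPolynomial hB (r i) (hb i).1 (hb i).2
  exact ⟨R, hR, fun z => (hr z i).trans (hRe z)⟩

lemma boundedNeighborhoods_singleton {n A : ℕ} (hA : 0 < A) :
    BoundedNeighborhoods A fun i : Fin n => {i} := by
  intro i
  refine ⟨by simpa using Nat.succ_le_of_lt hA, ?_⟩
  simp only [Finset.mem_singleton]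
  rw [Finset.filter_eq, if_pos (Finset.mem_univ i), Finset.card_singleton]
  exact hA

lemma frobNorm_le_sum_abs {ι : Type} [Fintype ι] {t : ℕ} (x : ι → Fin t → ℝ) :
    frobNorm x ≤ ∑ y : ι × Fin t, |x y.1 y.2| := by
  rw [frobNorm, Real.sqrt_le_iff]
  refine ⟨Finset.sum_nonneg fun _ _ => abs_nonneg _, ?_⟩
  rw [← Fintype.sum_prod_type' (fun i s => x i s ^ 2)]
  refine le_trans (le_of_eq ?_) (Finset.sum_sq_le_sq_sum_of_nonneg
    (s := Finset.univ) (f := fun y : ι × Fin t => |x y.1 y.2|) fun _ _ => abs_nonneg _)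
  simp [sq_abs]

/-- The function whose `j`-th coordinate is `c + a ∑ s, η (z j s)`. -/
noncomputable def columnMajorant (n t : ℕ) (c a : ℝ) (η : Polynomial ℝ) : VecFn n t :=
  fun z j => c + a * ∑ s, η.eval (z j s)

lemma continuous_of_abs_sub_le_sum {X : Type*} [Fintype X] {L : ℝ} {g : (X → ℝ) → ℝ}
    (hg : ∀ x y, |g x - g y| ≤ L * ∑ s, |x s - y s|) : Continuous g := by
  refine continuous_iff_continuousAt.2 fun x => ?_
  rw [ContinuousAt, tendsto_iff_dist_tendsto_zero]
  have h : Tendsto (fun y => L * ∑ s, |y s - x s|) (𝓝 x) (𝓝 (L * ∑ s, |x s - x s|)) :=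
    Continuous.tendsto (by fun_prop) x
  simp only [sub_self, abs_zero, Finset.sum_const_zero, mul_zero] at h
  exact squeeze_zero (fun _ => dist_nonneg) (fun y => by rw [Real.dist_eq]; exact hg y x) h

/-- Double counting: each row lies in at most `A` neighborhoods. This removes `N` from the majorant,
so that one test function serves every `f`. -/
lemma sum_neighborhoods_le {n A : ℕ} {N : Fin n → Finset (Fin n)} (hN : BoundedNeighborhoods A N)
    {φ : Fin n → ℝ} (hφ : ∀ j, 0 ≤ φ j) : ∑ i, ∑ j ∈ N i, φ j ≤ A * ∑ j, φ j := by
  rw [Finset.sum_comm' (t' := Finset.univ) (s' := fun j => Finset.univ.filter fun i => j ∈ N i)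
    (by simp), Finset.mul_sum]
  refine Finset.sum_le_sum fun j _ => ?_
  rw [Finset.sum_const, nsmul_eq_mul]
  exact mul_le_mul_of_nonneg_right (by exact_mod_cast (hN j).2) (hφ j)

/-- A polynomial operator as in `exists_polynomial_operator`. -/
structure IsLipschitzOperator (M : ℕ) (L ε : ℝ) {m : ℕ} (ν : Fin (m + 1) → ℝ)
    (β : Fin (m + 1) → Polynomial ℝ) (η : Polynomial ℝ) : Prop where
  sum_eq_one : ∀ u, ∑ j, (β j).eval u = 1
  nonneg : ∀ u, 0 ≤ η.eval u
  sq_sub_le : ∀ (X : Type) [Fintype X] [DecidableEq X], Fintype.card X ≤ M →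
    ∀ g : (X → ℝ) → ℝ, |g 0| ≤ L → (∀ x y, |g x - g y| ≤ L * ∑ s, |x s - y s|) → ∀ x : X → ℝ,
      (g x - ∑ v : X → Fin (m + 1), g (fun s => ν (v s)) * ∏ s, (β (v s)).eval (x s)) ^ 2 ≤
        ε + ∑ s, η.eval (x s)

/-- A bound on the coefficients of the polynomials approximating Lipschitz functions. -/
noncomputable def operatorCoeffBound (M : ℕ) (L : ℝ) {m : ℕ} (ν : Fin (m + 1) → ℝ)
    (β : Fin (m + 1) → Polynomial ℝ) : ℝ :=
  (m + 1) ^ M * ((L + L * (M * ∑ j, |ν j|)) * (1 + ∑ j, univCoeffSum (β j)) ^ M)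

lemma operatorCoeffBound_nonneg (M : ℕ) {L : ℝ} (hL : 0 ≤ L) {m : ℕ} (ν : Fin (m + 1) → ℝ)
    (β : Fin (m + 1) → Polynomial ℝ) : 0 ≤ operatorCoeffBound M L ν β := by
  have h1 : 0 ≤ ∑ j, univCoeffSum (β j) := Finset.sum_nonneg fun j _ => univCoeffSum_nonneg _
  have h2 : 0 ≤ ∑ j, |ν j| := Finset.sum_nonneg fun j _ => abs_nonneg _
  unfold operatorCoeffBound
  positivity

lemma exists_polynomialLocal_approx {T A n : ℕ} {L ε : ℝ} (hL : 0 < L) {m : ℕ}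
    {ν : Fin (m + 1) → ℝ} {β : Fin (m + 1) → Polynomial ℝ} {η : Polynomial ℝ}
    (hop : IsLipschitzOperator (A * T) L ε ν β η) {t : Fin (T + 1)} {f : VecFn n t}
    {N : Fin n → Finset (Fin n)} (hN : BoundedNeighborhoods A N)
    {g : ∀ i : Fin n, (N i → Fin t → ℝ) → ℝ} (hfg : ∀ z i, f z i = g i (rowsOf (N i) z))
    (hg : ∀ i, |g i 0| ≤ L ∧ ∀ x y, |g i x - g i y| ≤ L * frobNorm (x - y)) {D : ℕ} {B : ℝ}
    (hD : A * T * ∑ j, (β j).natDegree ≤ D) (hB : operatorCoeffBound (A * T) L ν β ≤ B) :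
    ∃ p : VecFn n t, ⟨t, p⟩ ∈ polynomialLocalFamily T A D B n ∧
      (∀ z, meanSqDist (f z) (p z) ≤
        meanInner (columnMajorant n t ε A η) (fun _ _ => 1) z) ∧
      Continuous (fun z => meanSqDist (f z) (p z)) ∧
      ∀ S : Set (Fin t), DependsOnCols S f → DependsOnCols S p := by
  classical
  let G : ∀ i : Fin n, (N i × Fin t → ℝ) → ℝ := fun i x => g i fun j s => x (j, s)
  have hG0 : ∀ i, |G i 0| ≤ L := fun i => (hg i).1
  have hGL : ∀ i x y, |G i x - G i y| ≤ L * ∑ s, |x s - y s| := fun i x y =>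
    ((hg i).2 _ _).trans (mul_le_mul_of_nonneg_left (frobNorm_le_sum_abs _) hL.le)
  have hfG : ∀ z i, f z i = G i fun y => z y.1 y.2 := hfg
  have hcard : ∀ i, Fintype.card (N i × Fin t) ≤ A * T := by
    intro i
    rw [Fintype.card_prod, Fintype.card_coe, Fintype.card_fin]
    exact Nat.mul_le_mul (hN i).1 (Nat.lt_succ_iff.1 t.2)
  let V : ∀ i : Fin n, (N i × Fin t → Fin (m + 1)) → ℝ := fun i v => G i fun s => ν (v s)
  let p : VecFn n t := fun z i => ∑ v : N i × Fin t → Fin (m + 1),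
    V i v * ∏ y, (β (v y)).eval (z y.1 y.2)
  have hV : ∀ i v, |V i v| ≤ L + L * ((A * T : ℕ) * ∑ j, |ν j|) := by
    intro i v
    have h1 := hGL i (fun s => ν (v s)) 0
    have h2 : ∑ s, |ν (v s) - (0 : N i × Fin t → ℝ) s| ≤ (A * T : ℕ) * ∑ j, |ν j| := by
      refine (Finset.sum_le_card_nsmul _ _ (∑ j, |ν j|) fun s _ => ?_).trans ?_
      · rw [Pi.zero_apply, sub_zero]
        exact Finset.single_le_sum (f := fun j => |ν j|) (fun _ _ => abs_nonneg _)
          (Finset.mem_univ (v s))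
      · rw [Finset.card_univ, nsmul_eq_mul]
        exact mul_le_mul_of_nonneg_right (by exact_mod_cast hcard i)
          (Finset.sum_nonneg fun _ _ => abs_nonneg _)
    have h3 := abs_add_le (V i v - G i 0) (G i 0)
    rw [sub_add_cancel] at h3
    have h4 : |V i v - G i 0| ≤ _ := h1
    linarith [mul_le_mul_of_nonneg_left h2 hL.le, hG0 i]
  have hGc : ∀ i, Continuous (G i) := fun i => continuous_of_abs_sub_le_sum (hGL i)
  refine ⟨p, ⟨N, hN, fun i => tensorOperatorPoly β (V i), fun z i => ?_, fun i => ⟨?_, fun e => ?_⟩⟩,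
    fun z => ?_, ?_, fun S hS z z' hz => ?_⟩
  · rw [eval_tensorOperatorPoly]
    rfl
  · exact (totalDegree_tensorOperatorPoly_le β (V i) (hcard i)).trans hD
  · refine (abs_coeff_le_coeffSum _ e).trans (le_trans ?_ hB)
    exact coeffSum_tensorOperatorPoly_le β (V i) (hcard i)
      ((abs_nonneg _).trans (hV i fun _ => 0)) (hV i)
  · rw [meanSqDist, meanInner]
    refine mul_le_mul_of_nonneg_left ?_ (by positivity)
    calc ∑ i, (f z i - p z i) ^ 2
        ≤ ∑ i, (ε + ∑ j ∈ N i, ∑ s, η.eval (z j s)) := by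
          refine Finset.sum_le_sum fun i _ => ?_
          have h := hop.sq_sub_le _ (hcard i) (G i) (hG0 i) (hGL i) fun y => z y.1 y.2
          rw [Fintype.sum_prod_type, Finset.sum_coe_sort (N i) fun j => ∑ s, η.eval (z j s)] at h
          rw [hfG]
          exact h
      _ ≤ ∑ _i : Fin n, ε + A * ∑ j, ∑ s, η.eval (z j s) := by
          rw [Finset.sum_add_distrib]
          exact add_le_add_right (sum_neighborhoods_le hN fun j =>
            Finset.sum_nonneg fun s _ => hop.nonneg _) _
      _ = _ := by
          simp only [columnMajorant, mul_one]
          rw [Finset.sum_add_distrib, ← Finset.mul_sum]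
  · have hf : ∀ i, Continuous fun z => f z i := fun i => by
      simp_rw [hfG]
      have h1 : Continuous fun (z : RMat n t) (y : N i × Fin t) => z y.1 y.2 := by fun_prop
      exact (hGc i).comp h1
    have hp : ∀ i, Continuous fun z => p z i := fun i => by
      refine continuous_finsetSum _ fun v _ => continuous_const.mul
        (continuous_finsetProd _ fun y _ => (β (v y)).continuous.comp (by fun_prop))
    unfold meanSqDist
    exact continuous_const.mul (continuous_finsetSum _ fun i _ => ((hf i).sub (hp i)).pow 2)
  -- The weights sum to one at every real point, so those of entries in ignored columns can be
  -- changed freely.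
  · funext i
    refine sum_mul_prod_congr_of_dependsOn {y : N i × Fin t | y.2 ∈ S} (V i) ?_
      (c := fun y j => (β j).eval (z y.1 y.2)) (c' := fun y j => (β j).eval (z' y.1 y.2))
      (fun _ => hop.sum_eq_one _) (fun _ => hop.sum_eq_one _) fun y hy => ?_
    · intro v v' hv
      -- Node values are extended by zero to a full matrix, so that column dependence of `f` passes
      -- to its values at the nodes.
      let ext : (N i × Fin t → Fin (m + 1)) → RMat n t := fun v j s =>
        if h : j ∈ N i then ν (v (⟨j, h⟩, s)) else 0
      have hext : ∀ v, V i v = f (ext v) i := by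
        intro v
        rw [hfG]
        have h1 : (fun y => ν (v y)) = fun y : N i × Fin t => ext v y.1 y.2 := by
          funext y
          simp [ext]
        exact congrArg (G i) h1
      rw [hext, hext, hS (ext v) (ext v') fun j s hs => ?_]
      by_cases h : j ∈ N i
      · simp only [ext, h, dif_pos]
        rw [hv (⟨j, h⟩, s) hs]
      · simp [ext, h]
    · funext j
      rw [hz y.1 y.2 hy]

lemma integrable_eval_gaussianRows {n t : ℕ} {Sig : Matrix (Fin t) (Fin t) ℝ}
    (hS : Sig.PosSemidef) (η : Polynomial ℝ) (j : Fin n) (s : Fin t) :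
    Integrable (fun z : RMat n t => η.eval (z j s)) (gaussianRows n Sig) :=
  (measurePreserving_gaussianRows_apply hS j s).integrable_comp_of_integrable
    (integrable_polynomial_gaussianReal η 0 _)

instance isProbabilityMeasure_gaussianRows (n : ℕ) {t : ℕ} (Sig : Matrix (Fin t) (Fin t) ℝ) :
    IsProbabilityMeasure (gaussianRows n Sig) := by
  have : IsProbabilityMeasure
      ((multivariateGaussian (0 : EuclideanSpace ℝ (Fin t)) Sig).map WithLp.ofLp) :=
    Measure.isProbabilityMeasure_map (by fun_prop)
  unfold gaussianRows
  infer_instance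

lemma integral_meanInner_columnMajorant_le {n t : ℕ} {C₀ ε c a : ℝ} (hn : 1 ≤ n) (hC₀ : 0 < C₀)
    (ha : 0 ≤ a) {η : Polynomial ℝ}
    (hη : ∀ v : NNReal, (v : ℝ) ≤ C₀ → ∫ u, η.eval u ∂(gaussianReal 0 v) ≤ ε)
    {Sig : Matrix (Fin t) (Fin t) ℝ} (hS : IsCovBelow C₀ Sig) :
    Integrable (fun z => meanInner (columnMajorant n t c a η) (fun _ _ => 1) z)
        (gaussianRows n Sig) ∧
      ∫ z, meanInner (columnMajorant n t c a η) (fun _ _ => 1) z ∂(gaussianRows n Sig) ≤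
        c + a * (t * ε) := by
  have hint := fun (j : Fin n) (s : Fin t) => integrable_eval_gaussianRows hS.1 η j s
  have hle : ∀ (j : Fin n) (s : Fin t), ∫ z : RMat n t, η.eval (z j s) ∂(gaussianRows n Sig) ≤ ε := by
    intro j s
    have hmp := measurePreserving_gaussianRows_apply hS.1 j s
    have h1 : ∫ z : RMat n t, η.eval (z j s) ∂(gaussianRows n Sig) =
        ∫ u, η.eval u ∂(gaussianReal 0 (Sig s s).toNNReal) := by
      rw [← hmp.map_eq, integral_map hmp.measurable.aemeasurable
        η.continuous.aestronglyMeasurable]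
    rw [h1]
    refine hη _ ?_
    rw [Real.coe_toNNReal']
    exact max_le (hS.diag_le s) hC₀.le
  have hcol : ∀ j : Fin n, Integrable (fun z : RMat n t => c + a * ∑ s, η.eval (z j s))
      (gaussianRows n Sig) := fun j =>
    (integrable_const c).add ((integrable_finsetSum _ fun s _ => hint j s).const_mul a)
  simp only [meanInner, columnMajorant, mul_one]
  refine ⟨(integrable_finsetSum _ fun j _ => hcol j).const_mul _, ?_⟩
  rw [integral_const_mul, integral_finsetSum _ fun j _ => hcol j]
  have hn' : (0 : ℝ) < n := by exact_mod_cast hn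
  rw [one_div, inv_mul_le_iff₀ hn']
  refine (Finset.sum_le_card_nsmul _ _ (c + a * (t * ε)) fun j _ => ?_).trans
    (by rw [Finset.card_univ, Fintype.card_fin, nsmul_eq_mul])
  rw [integral_add (integrable_const c)
    ((integrable_finsetSum _ fun s _ => hint j s).const_mul a), integral_const_mul,
    integral_finsetSum _ fun s _ => hint j s]
  refine add_le_add (by simp) (mul_le_mul_of_nonneg_left ?_ ha)
  exact (Finset.sum_le_card_nsmul _ _ ε fun s _ => hle j s).trans (by simp)

lemma columnMajorant_mem {T A n D : ℕ} {c a B : ℝ} (hA : 0 < A) (η : Polynomial ℝ)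
    (t : Fin (T + 1)) (hD : η.natDegree ≤ D) (hB : |c| + |a| * (T * univCoeffSum η) ≤ B) :
    ⟨t, columnMajorant n t c a η⟩ ∈ polynomialLocalFamily T A D B n := by
  classical
  refine ⟨fun i => {i}, boundedNeighborhoods_singleton hA, fun i => MvPolynomial.C c +
    MvPolynomial.C a * ∑ s, Polynomial.aeval
      (MvPolynomial.X ((⟨i, Finset.mem_singleton_self i⟩ : ({i} : Finset (Fin n))), s)) η,
    fun z i => ?_, fun i => ⟨?_, fun e => ?_⟩⟩
  · simp only [map_add, map_mul, map_sum, MvPolynomial.eval_C, eval_aeval_X]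
    rfl
  · refine (MvPolynomial.totalDegree_add _ _).trans (max_le (by simp) ?_)
    refine (MvPolynomial.totalDegree_mul _ _).trans ?_
    rw [MvPolynomial.totalDegree_C, zero_add]
    exact MvPolynomial.totalDegree_finsetSum_le fun s _ => (totalDegree_aeval_X_le _ _).trans hD
  · refine (abs_coeff_le_coeffSum _ e).trans (le_trans ?_ hB)
    refine (coeffSum_add_le _ _).trans (add_le_add (coeffSum_C_le c) ?_)
    refine (coeffSum_mul_le _ _).trans (mul_le_mul (coeffSum_C_le a) ?_ (coeffSum_nonneg _)
      (abs_nonneg _))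
    refine (coeffSum_sum_le _ _).trans ((Finset.sum_le_card_nsmul _ _ (univCoeffSum η)
      fun s _ => coeffSum_aeval_X_le _ _).trans ?_)
    rw [Finset.card_univ, Fintype.card_fin, nsmul_eq_mul]
    exact mul_le_mul_of_nonneg_right (by exact_mod_cast Nat.lt_succ_iff.1 t.2)
      (univCoeffSum_nonneg η)

lemma one_mem_polynomialLocalFamily {T A n D : ℕ} {B : ℝ} (hA : 0 < A) (hB : 1 ≤ B)
    (t : Fin (T + 1)) :
    ⟨t, fun _ _ => 1⟩ ∈ polynomialLocalFamily T A D B n := by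
  refine ⟨fun i => {i}, boundedNeighborhoods_singleton hA, fun i => 1, fun z i => by simp,
    fun i => ⟨by simp, fun e => ?_⟩⟩
  refine (abs_coeff_le_coeffSum _ e).trans (le_trans ?_ hB)
  simpa using coeffSum_C_le (σ := ({i} : Finset (Fin n)) × Fin t) 1

theorem IsLipschitzLocal.bcpApproximable {T : ℕ} {F : FnFamily T} (hF : IsLipschitzLocal F) :
    BCPApproximable.{u} F := by
  classical
  obtain ⟨A, L, hA, hL, hF⟩ := hF
  intro C₀ ε hC₀ hε
  -- The majorant has mean at most `ε' + A * (T * ε') = ε / 2`.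
  obtain ⟨ε', hε'⟩ : ∃ ε', ε' = ε / (2 * (1 + A * T)) := ⟨_, rfl⟩
  have hε'0 : 0 < ε' := by rw [hε']; positivity
  have hε'2 : ε' + A * (T * ε') = ε / 2 := by rw [hε']; field_simp
  obtain ⟨m, ν, β, η, hβ, hη0, hηint, happ⟩ := exists_polynomial_operator (A * T) hL hC₀ hε'0
  have hop : IsLipschitzOperator (A * T) L ε' ν β η := ⟨hβ, hη0, happ⟩
  -- `D` and `B` also accommodate the test functions `H` and `1`; these then lie in `P`, and
  -- adjoining them enlarges nothing.
  let D := A * T * ∑ j, (β j).natDegree + η.natDegree + 1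
  let B := operatorCoeffBound (A * T) L ν β + (|ε'| + |(A : ℝ)| * (T * univCoeffSum η)) + 1
  have hB1 := operatorCoeffBound_nonneg (A * T) hL.le ν β
  have hB2 : 0 ≤ |ε'| + |(A : ℝ)| * (T * univCoeffSum η) := by
    have := univCoeffSum_nonneg η
    positivity
  have hB0 : 0 < B := by positivity
  let P : FnFamily T := polynomialLocalFamily T A D B
  let H : ∀ n t : ℕ, VecFn n t := fun n t => columnMajorant n t ε' A η
  have hHP : ∀ (n : ℕ) (t : Fin (T + 1)), ⟨t, H n t⟩ ∈ P n := fun n t =>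
    columnMajorant_mem hA η t (by omega) (by linarith)
  have h1P : ∀ (n : ℕ) (t : Fin (T + 1)), ⟨t, fun _ _ => 1⟩ ∈ P n := fun n t =>
    one_mem_polynomialLocalFamily hA (by linarith) t
  have hP : BCPRepresentable P :=
    (isPolynomialLocal_polynomialLocalFamily hA (Nat.succ_pos _) hB0).bcpRepresentable
  have hpol : ∀ (n : ℕ) (t : Fin (T + 1)) (f : VecFn n t), ∃ p : VecFn n t,
      1 ≤ n → ⟨t, f⟩ ∈ F n → ⟨t, p⟩ ∈ P n ∧
        (∀ z, meanSqDist (f z) (p z) ≤ meanInner (H n t) (fun _ _ => 1) z) ∧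
        Continuous (fun z => meanSqDist (f z) (p z)) ∧
        ∀ S : Set (Fin t), DependsOnCols S f → DependsOnCols S p := by
    intro n t f
    by_cases h : 1 ≤ n ∧ ⟨t, f⟩ ∈ F n
    · obtain ⟨N, hN, g, hfg, hg⟩ := hF n h.1 t f h.2
      obtain ⟨p, hp⟩ := exists_polynomialLocal_approx hL hop hN hfg hg (D := D) (B := B)
        (by omega) (by linarith)
      exact ⟨p, fun _ _ => hp⟩
    -- A default polynomial outside `F`, so that `pol` is total.
    · exact ⟨0, fun hn hf => absurd ⟨hn, hf⟩ h⟩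
  choose pol hpol using hpol
  have hmean : ∀ n, 1 ≤ n → ∀ (t : Fin (T + 1)) (Sig : Matrix (Fin t) (Fin t) ℝ),
      IsCovBelow C₀ Sig →
      Integrable (fun z => meanInner (H n t) (fun _ _ => 1) z) (gaussianRows n Sig) ∧
      ∫ z, meanInner (H n t) (fun _ _ => 1) z ∂(gaussianRows n Sig) ≤ ε / 2 := by
    intro n hn t Sig hS
    have h := integral_meanInner_columnMajorant_le (c := ε') (a := A) hn hC₀ (by positivity)
      hηint hS
    refine ⟨h.1, h.2.trans ?_⟩
    rw [← hε'2]
    have : ((t : ℕ) : ℝ) ≤ T := by exact_mod_cast Nat.lt_succ_iff.1 t.2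
    gcongr
  refine ⟨P, fun n t f _ => pol n t f, hP, ?_, ?_⟩
  · intro n hn t f hf Sig hS
    obtain ⟨hp, hle, hcont, hdep⟩ := hpol n t f hn hf
    have hnn : ∀ z, 0 ≤ meanSqDist (f z) (pol n t f z) := fun z =>
      mul_nonneg (by positivity) (Finset.sum_nonneg fun i _ => sq_nonneg _)
    have hint : Integrable (fun z => meanSqDist (f z) (pol n t f z)) (gaussianRows n Sig) :=
      (hmean n hn t Sig hS).1.mono' hcont.aestronglyMeasurable
        (Eventually.of_forall fun z => by
          rw [Real.norm_eq_abs, abs_of_nonneg (hnn z)]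
          exact hle z)
    refine ⟨hp, hint, ?_, hdep⟩
    have := integral_mono hint (hmean n hn t Sig hS).1 hle
    linarith [(hmean n hn t Sig hS).2]
  · let Q : FnFamily T := fun n => {x | x.2 = H n x.1 ∨ x.2 = fun _ _ => 1}
    have hQP : ∀ (n : ℕ) (t : Fin (T + 1)) (q : VecFn n t), ⟨t, q⟩ ∈ Q n → ⟨t, q⟩ ∈ P n := by
      rintro n t q (h | h)
      · have h' : q = H n t := h
        exact h' ▸ hHP n t
      · have h' : q = fun _ _ => 1 := h
        exact h' ▸ h1P n t
    have hQpoly : ∀ (n : ℕ) (t : Fin (T + 1)) (q : VecFn n t), ⟨t, q⟩ ∈ Q n → IsPolyFn D q :=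
      fun n t q hq => isPolyFn_of_mem_polynomialLocalFamily hB0 (hQP n t q hq)
    refine ⟨Q, fun n _ t q hq => ⟨D, hQpoly n t q hq⟩, fun t _ => ⟨?_, ?_⟩⟩
    · intro q₁ q₂ hq₁ hq₂
      refine hP.mono fun n hn => ?_
      rintro x (hx | rfl | rfl)
      · exact hx
      · exact hQP n t _ (hq₁.1 n hn)
      · exact hQP n t _ (hq₂.1 n hn)
    · intro f Sig hf hS Ω _ μ _ z _ htest
      have hH : IsBoundedDegreeSeq Q t fun n => H n t :=
        ⟨fun n _ => Or.inl rfl, D, fun n _ => hQpoly n t _ (Or.inl rfl)⟩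
      have h1 : IsBoundedDegreeSeq Q t fun n _ _ => 1 :=
        ⟨fun n _ => Or.inr rfl, D, fun n _ => hQpoly n t _ (Or.inr rfl)⟩
      filter_upwards [htest _ _ hH h1] with ω hω
      -- Gaussian mean at most `ε / 2` plus test deviation below `ε / 4`; the remaining gap keeps
      -- the limsup strictly below `ε`.
      have hev : ∀ᶠ n in atTop, ENNReal.ofReal
          (meanSqDist (f n (z n ω)) (pol n t (f n) (z n ω))) ≤ ENNReal.ofReal (3 * ε / 4) := by
        filter_upwards [hω.eventually (gt_mem_nhds (by positivity : 0 < ε / 4)),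
          eventually_ge_atTop 1] with n hn hn1
        refine ENNReal.ofReal_le_ofReal ?_
        have h2 := (hpol n t (f n) hn1 (hf n hn1)).2.1 (z n ω)
        have h3 := (hmean n hn1 t (Sig n) (hS n hn1)).2
        linarith
      refine (limsup_le_of_le (by isBoundedDefault) hev).trans_lt ?_
      exact (ENNReal.ofReal_lt_ofReal_iff hε).2 (by linarith)

theorem mainTheorem6 (T : ℕ) :
    (∀ P : FnFamily T, IsPolynomialLocal P → BCPRepresentable P) ∧
      (∀ F : FnFamily T, IsLipschitzLocal F → BCPApproximable.{u} F) :=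
  ⟨fun _ hP => hP.bcpRepresentable, fun _ hF => hF.bcpApproximable⟩
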